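/- **Corollary 1.2.** Let $(M^4,g)$ be an oriented and time-oriented spacetime of signature $(-,+,+,+)$, and let $\Omega\subset M$ be a compact embedded spacelike 3-dimensional domain with smooth boundary $S=\partial\Omega$ (a closed surface) and outward unit normal $\nu$ (tangent to $\Omega$). Let $N$ be a future-directed timelike vector field on $S$ which is orthogonal to $\Omega$, extended smoothly, in an arbitrary way, to an open neighbourhood $U$ of $S$. Orient $S$ so that $N$, $\nu$ and the orientation of $S$ form the orientation of $M$. Let $(\overline M,\overline g)$ be the Minkowski spacetime with coordinates $(T,X,Y,Z)$, $\overline g=-dT^2+dX^2+dY^2+dZ^2$, oriented by $dT\wedge dX\wedge dY\wedge dZ$ and time-oriented by $\partial/\partial T$. A *reference* is a smooth embedding $\varphi:U\to\overline M$ preserving the orientation and the time orientation; it is a *4D isometric matching reference* if $\varphi^*\overline g=g$ at every point of $S$. The *Chen–Nester–Tung (CNT) quasi-local energy* is, with $\kappa=8\pi$, $$E(S,N,\varphi)=\frac1{2\kappa}\int_S\iota^*\Big[(\omega^a{}_b-\overline\omega^a{}_b)\wedge i_N\eta_a{}^b+\overline D_bN^a\,(\eta_a{}^b-\overline\eta_a{}^b)\Big],\qquad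 \eta_a{}^b=\tfrac12\sqrt{-\det g}\;g^{b\beta}\epsilon_{a\beta\mu\nu}\,dx^\mu\wedge dx^\nu,$$ where $\iota:S\to M$ is the inclusion, $\omega^a{}_b$ and $\overline\omega^a{}_b$ are the Levi-Civita connection forms of $g$ and $\varphi^*\overline g$, and $\overline D$, $\overline\eta_a{}^b$ are the covariant derivative and the 2-forms belonging to $\varphi^*\overline g$. Let $\varphi$ be any 4D isometric matching reference such that 1. $\varphi_*N=\partial/\partial T$ on $S$; 2. $\varphi(S)\subset\mathbb R^3$, where $\mathbb R^3$ is identified with a slice $\{T=c\}$, $c$ a constant (for instance $c=0$); and such that $\varphi_*\nu$ points, along $\varphi(S)$, out of the bounded region of $\mathbb R^3$ which $\varphi(S)$ encloses. Then $$E(S,N,\varphi)=\mathfrak m_{\mathrm{BY}}(\Omega)=\frac1{8\pi}\int_S(k_0-k)\,dV_S,$$ where $k$ is the mean curvature of $S$ in $\Omega$ with respect to $\nu$ and $k_0$ is the mean curvature of $\varphi(S)$ in $\mathbb R^3$ with respect to its outward unit normal (normalized so that a round sphere of radius $r$ in $\mathbb R^3$ has mean curvature $2/r$). -/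

import Mathlib

open scoped Manifold ContDiff
open Topology

attribute [instance] chartedSpaceSelf

noncomputable section

/-! ## Coordinate calculus on manifolds

In Mathlib the tangent space `TangentSpace I p` is by definition the model space `E`, and a
tangent vector at `p` is identified with its components in the preferred chart at `p`. In the
definitions below tangent vectors are therefore written as elements of `E`, and all coordinate
expressions at `p` are evaluated in the preferred chart at `p`. -/

/-- Euclidean space `ℝⁿ`. -/
abbrev Eu (n : ℕ) : Type := EuclideanSpace ℝ (Fin n)

/-- The standard basis of `ℝⁿ`. -/
def stdVec {n : ℕ} (i : Fin n) : Eu n := EuclideanSpace.single i (1 : ℝ)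

section Generic

variable {E H : Type*} [NormedAddCommGroup E] [NormedSpace ℝ E] [TopologicalSpace H]
  {Q : Type*} [TopologicalSpace Q] [ChartedSpace H Q]

/-- Fields of bilinear forms on the tangent spaces of a manifold `Q` with model space `E`. -/
abbrev BilinField (E : Type*) [NormedAddCommGroup E] [NormedSpace ℝ E] (Q : Type*) : Type _ :=
  Q → E →L[ℝ] E →L[ℝ] ℝ

/-- The derivative `df_p : T_p P → T_{f p} Q` of a map between manifolds. -/
def dmap {E' H' : Type*} [NormedAddCommGroup E'] [NormedSpace ℝ E'] [TopologicalSpace H']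
    {P : Type*} [TopologicalSpace P] [ChartedSpace H' P]
    (J : ModelWithCorners ℝ E' H') (I : ModelWithCorners ℝ E H) (f : P → Q) (p : P) :
    E' →L[ℝ] E :=
  mfderiv J I f p

/-- The tangent map at the point `x` of the parametrization inverse to the preferred chart
at `p`; the images of a basis of `E` are the coordinate vector fields of this chart. -/
def chartFrame (I : ModelWithCorners ℝ E H) (p : Q) (x : E) :
    E →L[ℝ] E :=
  mfderivWithin 𝓘(ℝ, E) I (extChartAt I p).symm (Set.range I) x

/-- The coordinate representation of a field of bilinear forms in the preferred chart at `p`. -/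
def coordBilin (I : ModelWithCorners ℝ E H) (B : BilinField E Q) (p : Q) (x : E) :
    E →L[ℝ] E →L[ℝ] ℝ :=
  (B ((extChartAt I p).symm x)).bilinearComp (chartFrame I p x) (chartFrame I p x)

/-- `D_u (B(v, w))` at `p`, in the preferred chart at `p` (with `v`, `w` constant in the chart). -/
def coordDeriv (I : ModelWithCorners ℝ E H) (B : BilinField E Q) (p : Q) (u v w : E) : ℝ :=
  fderivWithin ℝ (fun x => coordBilin I B p x v w) (Set.range I) (extChartAt I p p) u

/-- Christoffel symbols of the first kind of the metric `B` at `p`, in the preferred chart at `p`: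
`[uv, w] = ½ (D_u B(v,w) + D_v B(u,w) - D_w B(u,v))`, which is `B(∇_u v, w)` for the Levi-Civita
connection `∇` of `B` and vector fields `u`, `v` that are constant in the chart. -/
def christoffelFirst (I : ModelWithCorners ℝ E H) (B : BilinField E Q) (p : Q) (u v w : E) : ℝ :=
  (1 / 2) * (coordDeriv I B p u v w + coordDeriv I B p v u w - coordDeriv I B p w u v)

/-- Pullback of a field of bilinear forms. -/
def pullbackBilin {E' H' : Type*} [NormedAddCommGroup E'] [NormedSpace ℝ E'] [TopologicalSpace H']
    {P : Type*} [TopologicalSpace P] [ChartedSpace H' P]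
    (J : ModelWithCorners ℝ E' H') (I : ModelWithCorners ℝ E H) (f : P → Q)
    (B : BilinField E Q) : BilinField E' P :=
  fun p => (B (f p)).bilinearComp (dmap J I f p) (dmap J I f p)

/-- Smooth embeddings: smooth immersions that are topological embeddings. -/
structure IsSmoothEmb {E' H' : Type*} [NormedAddCommGroup E'] [NormedSpace ℝ E']
    [TopologicalSpace H'] {P : Type*} [TopologicalSpace P] [ChartedSpace H' P]
    (J : ModelWithCorners ℝ E' H') (I : ModelWithCorners ℝ E H) (f : P → Q) : Prop where
  contMDiff : ContMDiff J I ∞ f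
  injective_dmap : ∀ p, Function.Injective (dmap J I f p)
  isEmbedding : IsEmbedding f

end Generic

/-! ## Orientations, volume forms, integration of forms over closed surfaces -/

/-- An orientation of an `n`-manifold, given by a nowhere vanishing continuous `n`-form; a basis
of a tangent space is positive when the form is positive on it. -/
structure OrientationForm (n : ℕ) (Q : Type*) [TopologicalSpace Q] [ChartedSpace (Eu n) Q] where
  form : Q → Eu n [⋀^Fin n]→ₗ[ℝ] ℝ
  ne_zero : ∀ p, form p ≠ 0
  continuousOn : ∀ p : Q, ContinuousOn
    (fun x : Eu n => form ((extChartAt (𝓡 n) p).symm x)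
      (fun i => chartFrame (𝓡 n) p x (stdVec i))) (extChartAt (𝓡 n) p).target

section Oriented

variable {n : ℕ} {Q : Type*} [TopologicalSpace Q] [ChartedSpace (Eu n) Q]

/-- The matrix of components `g_{ab}` at `p`. -/
def gram (B : BilinField (Eu n) Q) (p : Q) : Matrix (Fin n) (Fin n) ℝ :=
  Matrix.of fun a b => B p (stdVec a) (stdVec b)

/-- The oriented volume form `√|det g| dx¹ ∧ … ∧ dxⁿ` of the metric `B` at `p`
(with the opposite sign if the coordinates are negatively oriented). -/
def volForm (o : OrientationForm n Q) (B : BilinField (Eu n) Q) (p : Q) (v : Fin n → Eu n) : ℝ :=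
  (SignType.sign (o.form p stdVec) : ℝ) * √|(gram B p).det| *
    (Matrix.of fun i k => v i k).det

/-- The connection form `ω^a_b` of the Levi-Civita connection of `B` in the coordinate frame,
at `p`, evaluated on `v`: `ω^a_b(v) = Γ^a_{cb} v^c`. -/
def connForm (B : BilinField (Eu n) Q) (p : Q) (a b : Fin n) (v : Eu n) : ℝ :=
  ∑ d, (gram B p)⁻¹ a d * christoffelFirst (𝓡 n) B p v (stdVec b) (stdVec d)

/-- Components of the vector field `N` in the preferred chart at `p`. -/
def coordVec (N : Q → Eu n) (p : Q) (x : Eu n) : Eu n :=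
  dmap (𝓡 n) 𝓘(ℝ, Eu n) (extChartAt (𝓡 n) p) ((extChartAt (𝓡 n) p).symm x)
    (N ((extChartAt (𝓡 n) p).symm x))

/-- The component `D_b N^a = ∂_b N^a + Γ^a_{bc} N^c` at `p` of the covariant derivative of `N`
with respect to the Levi-Civita connection of `B`. -/
def covDerivComp (B : BilinField (Eu n) Q) (N : Q → Eu n) (p : Q)
    (b a : Fin n) : ℝ :=
  (fderiv ℝ (coordVec N p) (extChartAt (𝓡 n) p p) (stdVec b)) a +
    ∑ c, connForm B p a c (stdVec b) * N p c

end Oriented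

section Surface

variable {S : Type*} [TopologicalSpace S] [ChartedSpace (Eu 2) S]

/-- The integral over an oriented closed surface `S` of the 2-form `α` (the 2-form being given by
its values `α s u v`), by means of a partition of unity subordinate to the preferred charts. -/
def formIntegral [IsManifold (𝓡 2) ∞ S] [CompactSpace S] [T2Space S]
    (o : OrientationForm 2 S) (α : S → Eu 2 → Eu 2 → ℝ) : ℝ :=
  let ρ := Classical.choose (SmoothPartitionOfUnity.exists_isSubordinate_chartAt_source (𝓡 2) S)
  ∑ᶠ i : S, ∫ x in (extChartAt (𝓡 2) i).target,
    (SignType.sign (o.form ((extChartAt (𝓡 2) i).symm x)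
        (fun k => chartFrame (𝓡 2) i x (stdVec k))) : ℝ) *
      ρ i ((extChartAt (𝓡 2) i).symm x) *
      α ((extChartAt (𝓡 2) i).symm x)
        (chartFrame (𝓡 2) i x (stdVec 0)) (chartFrame (𝓡 2) i x (stdVec 1))

/-- The integral `∫_S f dV_S` with respect to the area form of the Riemannian metric `h`. -/
def areaIntegral [IsManifold (𝓡 2) ∞ S] [CompactSpace S] [T2Space S]
    (o : OrientationForm 2 S) (h : BilinField (Eu 2) S) (f : S → ℝ) : ℝ :=
  formIntegral o fun s u v => f s * volForm o h s ![u, v]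

/-- The mean curvature at `s`, with respect to the unit normal field `n`, of a surface
`f : S → Q` immersed in the Riemannian 3-manifold `(Q, B)`: the trace of
`(u, v) ↦ -B(∇_u f_* v, n)`, with `∇` the Levi-Civita connection of `B`. With this sign a round
sphere of radius `r` in `ℝ³` has mean curvature `2 / r` with respect to the outward normal. -/
def meanCurvature {E H : Type*} [NormedAddCommGroup E] [NormedSpace ℝ E] [TopologicalSpace H]
    {Q : Type*} [TopologicalSpace Q] [ChartedSpace H Q] (I : ModelWithCorners ℝ E H)
    (B : BilinField E Q) (f : S → Q) (n : S → E) (s : S) : ℝ :=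
  let F : Eu 2 → E := extChartAt I (f s) ∘ f ∘ (extChartAt (𝓡 2) s).symm
  let x : Eu 2 := extChartAt (𝓡 2) s s
  let d : Fin 2 → E := fun i => fderiv ℝ F x (stdVec i)
  let h : Matrix (Fin 2) (Fin 2) ℝ := Matrix.of fun i k => B (f s) (d i) (d k)
  ∑ i, ∑ k, -(h⁻¹ i k * (B (f s) (fderiv ℝ (fderiv ℝ F) x (stdVec i) (stdVec k)) (n s) +
      christoffelFirst I B (f s) (d i) (d k) (n s)))

end Surface

/-! ## Spacetimes -/

/-- A spacetime structure on a 4-manifold: a smooth Lorentzian metric of signature `(-,+,+,+)`,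
an orientation, and a time orientation (given by a continuous timelike vector field). -/
structure Spacetime (M : Type*) [TopologicalSpace M] [ChartedSpace (Eu 4) M]
    [IsManifold (𝓡 4) ∞ M] where
  g : BilinField (Eu 4) M
  symm : ∀ (p : M) (u v : Eu 4), g p u v = g p v u
  lorentz : ∀ p : M, ∃ e : Module.Basis (Fin 4) ℝ (Eu 4),
    ∀ i k, g p (e i) (e k) = Matrix.diagonal ![(-1 : ℝ), 1, 1, 1] i k
  smooth : ∀ p : M, ContDiffOn ℝ ∞ (coordBilin (𝓡 4) g p) (extChartAt (𝓡 4) p).target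
  orient : OrientationForm 4 M
  time : M → Eu 4
  time_timelike : ∀ p, g p (time p) (time p) < 0
  time_continuous : Continuous (fun p => (⟨p, time p⟩ : TangentBundle (𝓡 4) M))

namespace Spacetime

variable {M : Type*} [TopologicalSpace M] [ChartedSpace (Eu 4) M] [IsManifold (𝓡 4) ∞ M]

/-- Future-directed timelike tangent vectors. -/
def Future (X : Spacetime M) (p : M) (v : Eu 4) : Prop :=
  X.g p v v < 0 ∧ X.g p v (X.time p) < 0

/-- The 2-form `η_a^b = ½ √(-det g) g^{bβ} ε_{aβμν} dx^μ ∧ dx^ν` of the metric `B` at `p`,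
evaluated on `(u, v)`. -/
def eta (o : OrientationForm 4 M) (B : BilinField (Eu 4) M) (p : M) (a b : Fin 4)
    (u v : Eu 4) : ℝ :=
  ∑ β, (gram B p)⁻¹ b β * volForm o B p ![stdVec a, stdVec β, u, v]

/-- The 2-form
`(ω^a_b - ω̄^a_b) ∧ i_N η_a^b + D̄_b N^a (η_a^b - η̄_a^b)` at `p`, evaluated on `(u, v)`; the barred
quantities belong to the metric `B'`, the others to the metric `B`. -/
def cntForm (o : OrientationForm 4 M) (B B' : BilinField (Eu 4) M)
    (N : M → Eu 4) (p : M) (u v : Eu 4) : ℝ :=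
  ∑ a, ∑ b,
    (((connForm B p a b u - connForm B' p a b u) * eta o B p a b (N p) v
      - (connForm B p a b v - connForm B' p a b v) * eta o B p a b (N p) u)
      + covDerivComp B' N p b a * (eta o B p a b u v - eta o B' p a b u v))

/-- `φ : U → M'` is a reference near `K ⊆ M`: a smooth embedding of the open neighbourhood `U`
of `K` that preserves the orientation and the time orientation. -/
structure IsReference {M' : Type*} [TopologicalSpace M'] [ChartedSpace (Eu 4) M']
    [IsManifold (𝓡 4) ∞ M'] (X : Spacetime M) (Y : Spacetime M')
    (K U : Set M) (φ : M → M') : Prop where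
  isOpen : IsOpen U
  subset : K ⊆ U
  contMDiffOn : ContMDiffOn (𝓡 4) (𝓡 4) ∞ φ U
  injective_dmap : ∀ p ∈ U, Function.Injective (dmap (𝓡 4) (𝓡 4) φ p)
  isEmbedding : IsEmbedding (U.domRestrict φ)
  orient : ∀ p ∈ U, ∀ v : Fin 4 → Eu 4, 0 < X.orient.form p v →
    0 < Y.orient.form (φ p) (fun i => dmap (𝓡 4) (𝓡 4) φ p (v i))
  time : ∀ p ∈ U, ∀ v : Eu 4, X.Future p v →
    Y.g (φ p) (dmap (𝓡 4) (𝓡 4) φ p v) (dmap (𝓡 4) (𝓡 4) φ p v) < 0 →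
    Y.Future (φ p) (dmap (𝓡 4) (𝓡 4) φ p v)

/-- A 4D isometric matching reference: a reference with `φ^* ḡ = g` at the points of `K`. -/
structure IsMatchingReference {M' : Type*} [TopologicalSpace M'] [ChartedSpace (Eu 4) M']
    [IsManifold (𝓡 4) ∞ M'] (X : Spacetime M) (Y : Spacetime M')
    (K U : Set M) (φ : M → M') : Prop extends IsReference X Y K U φ where
  isometric : ∀ p ∈ K, pullbackBilin (𝓡 4) (𝓡 4) φ Y.g p = X.g p

/-- The Chen-Nester-Tung quasi-local energy (with `κ = 8π`) of the oriented closed surface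
`ι : S → M` with respect to `N` and the reference `φ` into the spacetime `Y`. -/
def cntEnergy {M' : Type*} [TopologicalSpace M'] [ChartedSpace (Eu 4) M']
    [IsManifold (𝓡 4) ∞ M'] (X : Spacetime M) (Y : Spacetime M')
    {S : Type*} [TopologicalSpace S] [ChartedSpace (Eu 2) S] [IsManifold (𝓡 2) ∞ S]
    [CompactSpace S] [T2Space S] (o : OrientationForm 2 S) (ι : S → M)
    (N : M → Eu 4) (φ : M → M') : ℝ :=
  1 / (2 * (8 * Real.pi)) * formIntegral o fun s u v =>
    cntForm X.orient X.g (pullbackBilin (𝓡 4) (𝓡 4) φ Y.g) N (ι s)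
      (dmap (𝓡 2) (𝓡 4) ι s u) (dmap (𝓡 2) (𝓡 4) ι s v)

end Spacetime

/-! ## Minkowski space -/

/-- The Euclidean inner product of `ℝⁿ`, as a bilinear form. -/
def euclidForm (n : ℕ) : Eu n →L[ℝ] Eu n →L[ℝ] ℝ := innerSL ℝ

theorem euclidForm_apply {n : ℕ} (u v : Eu n) : euclidForm n u v = inner ℝ u v := rfl

theorem chartFrame_self {n : ℕ} (p x : Eu n) :
    chartFrame (𝓡 n) p x = ContinuousLinearMap.id ℝ (Eu n) := by
  simp only [chartFrame, ModelWithCorners.range_eq_univ, mfderivWithin_univ]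
  exact mfderiv_id

/-- The bilinear form `-u⁰v⁰ + u¹v¹ + u²v² + u³v³`. -/
def minkowskiForm : Eu 4 →L[ℝ] Eu 4 →L[ℝ] ℝ :=
  euclidForm 4 -
    (2 : ℝ) • (euclidForm 4 (stdVec 0)).smulRight (euclidForm 4 (stdVec 0))

theorem minkowskiForm_apply (u v : Eu 4) :
    minkowskiForm u v = - (u 0 * v 0) + u 1 * v 1 + u 2 * v 2 + u 3 * v 3 := by
  have h : inner ℝ u v = u 0 * v 0 + u 1 * v 1 + u 2 * v 2 + u 3 * v 3 := by
    simp [PiLp.inner_apply, Fin.sum_univ_four]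
    ring
  simp [minkowskiForm, euclidForm_apply, stdVec, h, EuclideanSpace.inner_single_left]
  ring

/-- Minkowski space, with coordinates `(T, X, Y, Z) = (x⁰, x¹, x², x³)`, oriented by
`dT ∧ dX ∧ dY ∧ dZ` and time-oriented by `∂/∂T`. -/
def minkowski : Spacetime (Eu 4) where
  g := fun _ => minkowskiForm
  symm := by
    intro p u v
    change minkowskiForm u v = minkowskiForm v u
    rw [minkowskiForm_apply, minkowskiForm_apply]
    ring
  lorentz := by
    intro p
    refine ⟨(EuclideanSpace.basisFun (Fin 4) ℝ).toBasis, ?_⟩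
    intro i k
    change minkowskiForm ((EuclideanSpace.basisFun (Fin 4) ℝ).toBasis i)
      ((EuclideanSpace.basisFun (Fin 4) ℝ).toBasis k) = _
    rw [minkowskiForm_apply]
    fin_cases i <;> fin_cases k <;> simp
  smooth := by
    intro p
    have h : coordBilin (𝓡 4) (fun _ : Eu 4 => minkowskiForm) p = fun _ => minkowskiForm := by
      funext x
      simp [coordBilin, chartFrame_self]
      rfl
    rw [h]
    exact contDiffOn_const
  orient :=
    { form := fun _ => (EuclideanSpace.basisFun (Fin 4) ℝ).toBasis.det
      ne_zero := fun _ => (EuclideanSpace.basisFun (Fin 4) ℝ).toBasis.det_ne_zero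
      continuousOn := by
        intro p
        simp only [chartFrame_self]
        exact continuousOn_const }
  time := fun _ => (stdVec 0 : Eu 4)
  time_timelike := by
    intro p
    change minkowskiForm (stdVec 0) (stdVec 0) < 0
    rw [minkowskiForm_apply]
    simp [stdVec]
  time_continuous := by
    have h : ContMDiff (𝓡 4) (𝓡 4).tangent 0
        (fun p : Eu 4 => (⟨p, (stdVec 0 : Eu 4)⟩ : TangentBundle (𝓡 4) (Eu 4))) :=
      contMDiff_vectorSpace_iff_contDiff.2 (contDiff_const (c := (stdVec 0 : Eu 4)))
    exact h.continuous

/-- The spatial part `(X, Y, Z)` of `(T, X, Y, Z)`. -/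
def spatial : Eu 4 →L[ℝ] Eu 3 :=
  LinearMap.toContinuousLinearMap
    { toFun := fun x => WithLp.toLp 2 fun i : Fin 3 => x i.succ
      map_add' := fun _ _ => rfl
      map_smul' := fun _ _ => rfl }

/-! ## Outward normals and the Brown-York mass -/

section BrownYork

variable {S : Type*} [TopologicalSpace S] [ChartedSpace (Eu 2) S]

/-- `n` is the outward unit normal field of the closed surface `f : S → ℝ³`: the unit normal field
that points out of the bounded open set which is enclosed by the surface. -/
def IsOutwardNormalEuclidean (f : S → Eu 3) (n : S → Eu 3) : Prop :=
  ∃ D : Set (Eu 3), IsOpen D ∧ Bornology.IsBounded D ∧ frontier D = Set.range f ∧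
    ∀ s : S, inner ℝ (n s) (n s) = (1 : ℝ) ∧
      (∀ u : Eu 2, inner ℝ (n s) (dmap (𝓡 2) (𝓡 3) f s u) = (0 : ℝ)) ∧
      ∃ ε > 0, ∀ t ∈ Set.Ioo 0 ε, f s + t • n s ∉ closure D ∧ f s - t • n s ∈ D

variable {Ω : Type*} [TopologicalSpace Ω] [ChartedSpace (EuclideanHalfSpace 3) Ω]

/-- `ν` is the outward unit normal field, in the Riemannian 3-manifold with boundary `(Ω, B)`, of
its boundary, parametrized by `b : S → Ω`. The charts of `Ω` take values in the half-space
`{x | 0 ≤ x 0}`, so that a vector at the boundary points outwards when its component `0` is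
negative. -/
def IsOutwardNormalBoundary (B : BilinField (Eu 3) Ω) (b : S → Ω)
    (ν : S → Eu 3) : Prop :=
  ∀ s : S, B (b s) (ν s) (ν s) = 1 ∧
    (∀ u : Eu 2, B (b s) (ν s) (dmap (𝓡 2) (𝓡∂ 3) b s u) = 0) ∧
    ν s 0 < 0

/-- The Brown-York mass `(1/8π) ∫_S (k₀ - k) dV_S`, where `k` is the mean curvature of the boundary
`b : S → Ω` of `(Ω, B)` with respect to `ν`, and `k₀` is the mean curvature of `f : S → ℝ³` with
respect to `n₀`; these have to be the outward unit normal fields. -/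
def brownYorkMass [IsManifold (𝓡 2) ∞ S] [CompactSpace S] [T2Space S] (o : OrientationForm 2 S)
    (B : BilinField (Eu 3) Ω) (b : S → Ω) (ν : S → Eu 3)
    (f : S → Eu 3) (n₀ : S → Eu 3) : ℝ :=
  1 / (8 * Real.pi) * areaIntegral o (pullbackBilin (𝓡 2) (𝓡∂ 3) b B) fun s =>
    meanCurvature (𝓡 3) (fun _ => euclidForm 3) f n₀ s - meanCurvature (𝓡∂ 3) B b ν s

end BrownYork

end

/-! ## Second derivatives along submanifolds -/

section Calculus

variable {E₁ E₂ : Type*} [NormedAddCommGroup E₁] [NormedSpace ℝ E₁]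
  [NormedAddCommGroup E₂] [NormedSpace ℝ E₂]

/-! At each point of `S` the integrand is `2 (k₀ - k)` times the area form. The metrics `g` and `φ^*
ḡ` agree along `S`, so `η = η̄` there and the term with `D̄N` drops out; in particular the extension
of `N` off `S` has no influence. Agreement along `S` also makes the derivatives of the two metrics
in directions tangent to `S` equal (`coordDeriv_eq_of_eq_along`). Hence in `Γ(u,v,w) - Γ̄(u,v,w)`,
with `u` tangent to `S`, the term `D_u B(v,w)` cancels and the rest is skew in `v`, `w`
(`christoffelFirst_sub`).

This skew form is contracted with `i_N η` in a frame `N, n, t₀, t₁`. A determinant into which `N`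
and a vector tangent to `S` are already inserted sees only pairs made of `n` and a tangent vector.
What remains is `2 h^{ik} (Γ - Γ̄)(t_i, t_k, n)` times the volume of the frame
(`IsAdaptedFrame.contraction`, `cntForm_eq_of_isAdaptedFrame`), and that volume gives the area form
of `S` (`volForm_surface`).

The trace is a difference of mean curvatures because the second fundamental form is natural under
pullback (`secondForm_pullbackBilin`). Through `j`, `k` is computed from `g` and `ι = j ∘ b`.
Through `φ`, the second fundamental form of the same `ι` for `φ^* ḡ` is that of `φ ∘ ι` in flat
space, paired with `φ_* ν`. Since `φ_* N = ∂/∂T`, the isometry makes `φ_* ν` spatial, and it is the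
outward unit normal by `eq_of_unit_normal`; this yields `k₀`. In the difference the second
derivatives of `ι` cancel, leaving exactly the Christoffel trace. -/

theorem ContDiffWithinAt.differentiableWithinAt_fderivWithin {F : E₁ → E₂} {R : Set E₁} {x : E₁}
    (hF : ContDiffWithinAt ℝ 2 F R x) (hR : UniqueDiffOn ℝ R) (hx : x ∈ R) :
    DifferentiableWithinAt ℝ (fderivWithin ℝ F R) R x :=
  (hF.fderivWithin_right (m := 1) hR (by norm_num [one_add_one_eq_two]) hx).differentiableWithinAt
    one_ne_zero

theorem differentiable_flip (E₁ E₂ : Type*) [NormedAddCommGroup E₁] [NormedSpace ℝ E₁]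
    [NormedAddCommGroup E₂] [NormedSpace ℝ E₂] :
    Differentiable ℝ (fun L : E₁ →L[ℝ] E₂ →L[ℝ] ℝ => L.flip) :=
  (ContinuousLinearMap.flipₗᵢ ℝ E₁ E₂ ℝ).toContinuousLinearEquiv.toContinuousLinearMap.differentiable

theorem DifferentiableWithinAt.bilinearComp {E₀ : Type*} [NormedAddCommGroup E₀]
    [NormedSpace ℝ E₀] {G : E₀ → E₂ →L[ℝ] E₂ →L[ℝ] ℝ} {A : E₀ → E₁ →L[ℝ] E₂} {R : Set E₀} {x : E₀}
    (hG : DifferentiableWithinAt ℝ G R x) (hA : DifferentiableWithinAt ℝ A R x) :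
    DifferentiableWithinAt ℝ (fun y => (G y).bilinearComp (A y) (A y)) R x := by
  -- `bilinearComp` unfolds to composing, flipping, composing and flipping again; each of these
  -- operations preserves differentiability.
  have h0 : DifferentiableWithinAt ℝ (fun y => (G y).comp (A y)) R x := hG.clm_comp hA
  have h1 : DifferentiableWithinAt ℝ (fun y => ((G y).comp (A y)).flip) R x :=
    DifferentiableAt.comp_differentiableWithinAt (𝕜 := ℝ) (E := E₀) (f := fun y => (G y).comp (A y))
      (g := fun L : E₁ →L[ℝ] E₂ →L[ℝ] ℝ => L.flip) x (differentiable_flip E₁ E₂ _) h0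
  have h2 : DifferentiableWithinAt ℝ (fun y => (((G y).comp (A y)).flip).comp (A y)) R x :=
    DifferentiableWithinAt.clm_comp (𝕜 := ℝ) (E := E₀) (c := fun y => ((G y).comp (A y)).flip) h1 hA
  exact DifferentiableAt.comp_differentiableWithinAt (𝕜 := ℝ) (E := E₀)
      (f := fun y => (((G y).comp (A y)).flip).comp (A y))
      (g := fun L : E₁ →L[ℝ] E₁ →L[ℝ] ℝ => L.flip) x (differentiable_flip E₁ E₁ _) h2

/-- Derivative of `x ↦ G (F x) (DF x v) (DF x w)`. -/
theorem fderivWithin_bilin_comp {F : E₁ → E₂} {G : E₂ → E₂ →L[ℝ] E₂ →L[ℝ] ℝ} {R : Set E₁}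
    {R' : Set E₂} {x : E₁} (hG : DifferentiableWithinAt ℝ G R' (F x))
    (hF : ContDiffWithinAt ℝ 2 F R x) (hR : UniqueDiffOn ℝ R) (hx : x ∈ R)
    (hRR' : Set.MapsTo F R R') (u v w : E₁) :
    fderivWithin ℝ (fun y => G (F y) (fderivWithin ℝ F R y v) (fderivWithin ℝ F R y w)) R x u =
      fderivWithin ℝ G R' (F x) (fderivWithin ℝ F R x u) (fderivWithin ℝ F R x v)
          (fderivWithin ℝ F R x w) +
        G (F x) (fderivWithin ℝ (fderivWithin ℝ F R) R x u v) (fderivWithin ℝ F R x w) +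
        G (F x) (fderivWithin ℝ F R x v) (fderivWithin ℝ (fderivWithin ℝ F R) R x u w) := by
  have h1 := hF.differentiableWithinAt_fderivWithin hR hx
  have h2 := (hF.differentiableWithinAt two_ne_zero).hasFDerivWithinAt
  have h3 : HasFDerivWithinAt (G ∘ F) _ R x :=
    HasFDerivWithinAt.comp (g := G) x hG.hasFDerivWithinAt h2 hRR'
  have hv := h1.hasFDerivWithinAt.clm_apply (hasFDerivWithinAt_const v x R)
  have hw := h1.hasFDerivWithinAt.clm_apply (hasFDerivWithinAt_const w x R)
  have h4 := (h3.clm_apply hv).clm_apply hw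
  have h5 := h4.fderivWithin (hR x hx)
  have h6 := congrArg (fun L => L u) h5
  simp only [Function.comp_def] at h6
  rw [h6]
  simp
  ring

/-- The second derivative of a composition. -/
theorem fderivWithin_fderivWithin_comp {E₀ : Type*} [NormedAddCommGroup E₀] [NormedSpace ℝ E₀]
    {f : E₀ → E₁} {F : E₁ → E₂} {R₀ : Set E₀} {R : Set E₁} {x : E₀}
    (hF : ContDiffWithinAt ℝ 2 F R (f x)) (hf : ContDiffWithinAt ℝ 2 f R₀ x)
    (hR₀ : UniqueDiffOn ℝ R₀) (hx : x ∈ R₀)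
    (hR : UniqueDiffOn ℝ R) (hRR : Set.MapsTo f R₀ R) (u v : E₀) :
    fderivWithin ℝ (fderivWithin ℝ (F ∘ f) R₀) R₀ x u v =
      fderivWithin ℝ (fderivWithin ℝ F R) R (f x) (fderivWithin ℝ f R₀ x u)
          (fderivWithin ℝ f R₀ x v) +
        fderivWithin ℝ F R (f x) (fderivWithin ℝ (fderivWithin ℝ f R₀) R₀ x u v) := by
  have e1 : ∀ᶠ y in 𝓝[R₀] x, ContDiffWithinAt ℝ 2 f R₀ y := by
    have := hf.eventually (by norm_num)
    rwa [Set.insert_eq_of_mem hx] at this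
  have e2 : ∀ᶠ z in 𝓝[R] (f x), ContDiffWithinAt ℝ 2 F R z := by
    have := hF.eventually (by norm_num)
    rwa [Set.insert_eq_of_mem (hRR hx)] at this
  have e3 : ∀ᶠ y in 𝓝[R₀] x, ContDiffWithinAt ℝ 2 F R (f y) :=
    (hf.continuousWithinAt.tendsto_nhdsWithin hRR).eventually e2
  -- To differentiate the chain rule it must hold near `x` within `R₀`, not only at `x`.
  have e4 : fderivWithin ℝ (F ∘ f) R₀ =ᶠ[𝓝[R₀] x]
      fun y => (fderivWithin ℝ F R (f y)).comp (fderivWithin ℝ f R₀ y) := by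
    filter_upwards [e1, e3, self_mem_nhdsWithin] with y h1 h3 hy
    exact fderivWithin_comp y (h3.differentiableWithinAt two_ne_zero)
      (h1.differentiableWithinAt two_ne_zero) hRR (hR₀ y hy)
  have d1 := (hF.differentiableWithinAt_fderivWithin hR (hRR hx)).hasFDerivWithinAt.comp x
    (hf.differentiableWithinAt two_ne_zero).hasFDerivWithinAt hRR
  have d2 := (hf.differentiableWithinAt_fderivWithin hR₀ hx).hasFDerivWithinAt
  have d3 := (d1.clm_comp d2).fderivWithin (hR₀ x hx)
  simp only [Function.comp_def] at d3
  rw [e4.fderivWithin_eq_of_mem hx, d3]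
  simp [add_comm]

end Calculus

/-! ### Naturality of Christoffel symbols and second fundamental forms under pullback -/

section Pullback

variable {E H E' H' E'' H'' : Type*} [NormedAddCommGroup E] [NormedSpace ℝ E] [TopologicalSpace H]
  [NormedAddCommGroup E'] [NormedSpace ℝ E'] [TopologicalSpace H']
  [NormedAddCommGroup E''] [NormedSpace ℝ E''] [TopologicalSpace H'']
  {Q : Type*} [TopologicalSpace Q] [ChartedSpace H Q]
  {P : Type*} [TopologicalSpace P] [ChartedSpace H' P]
  {S : Type*} [TopologicalSpace S] [ChartedSpace H'' S]
  {I : ModelWithCorners ℝ E H} {J : ModelWithCorners ℝ E' H'} {K : ModelWithCorners ℝ E'' H''}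

/-- The second derivative at `p` of the coordinate representation of `f`. -/
noncomputable def coordHess (J : ModelWithCorners ℝ E' H') (I : ModelWithCorners ℝ E H) (f : P → Q) (p : P) :
    E' →L[ℝ] E' →L[ℝ] E :=
  fderivWithin ℝ (fderivWithin ℝ (writtenInExtChartAt J I p f) (Set.range J)) (Set.range J)
    (extChartAt J p p)

/-- The second fundamental form `B(∇_u f_* v, n)` of the map `f`. -/
noncomputable def secondForm (J : ModelWithCorners ℝ E' H') (I : ModelWithCorners ℝ E H) (B : BilinField E Q)
    (f : P → Q) (p : P) (u v : E') (n : E) : ℝ :=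
  B (f p) (coordHess J I f p u v) n +
    christoffelFirst I B (f p) (dmap J I f p u) (dmap J I f p v) n

theorem contDiffWithinAt_writtenInExtChartAt {n : ℕ∞ω} {f : P → Q} {p : P}
    (hf : ContMDiffAt J I n f p) :
    ContDiffWithinAt ℝ n (writtenInExtChartAt J I p f) (Set.range J) (extChartAt J p p) :=
  (contMDiffAt_iff.1 hf).2

theorem dmap_eq_fderivWithin {f : P → Q} {p : P} (hf : MDifferentiableAt J I f p) :
    dmap J I f p =
      fderivWithin ℝ (writtenInExtChartAt J I p f) (Set.range J) (extChartAt J p p) := by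
  unfold dmap mfderiv
  exact if_pos hf

theorem dmap_comp {f : P → Q} {g : S → P} {s : S} (hf : MDifferentiableAt J I f (g s))
    (hg : MDifferentiableAt K J g s) (u : E'') :
    dmap K I (f ∘ g) s u = dmap J I f (g s) (dmap K J g s u) := by
  unfold dmap
  rw [mfderiv_comp s hf hg]
  rfl

theorem mapsTo_writtenInExtChartAt (f : P → Q) (p : P) (R : Set E') :
    Set.MapsTo (writtenInExtChartAt J I p f) R (Set.range I) :=
  fun x _ => by
    simp only [writtenInExtChartAt, Function.comp_apply, extChartAt_coe]
    exact Set.mem_range_self _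

theorem writtenInExtChartAt_self (f : P → Q) (p : P) :
    writtenInExtChartAt J I p f (extChartAt J p p) = extChartAt I (f p) (f p) := by
  simp [writtenInExtChartAt]

/-- The coordinate representation of a pullback. -/
theorem coordBilin_pullbackBilin [IsManifold J ∞ P] [IsManifold I ∞ Q] (B : BilinField E Q)
    {f : P → Q} {p : P} (hf : ContMDiffAt J I 2 f p) :
    coordBilin J (pullbackBilin J I f B) p =ᶠ[𝓝[Set.range J] (extChartAt J p p)] fun x =>
      (coordBilin I B (f p) (writtenInExtChartAt J I p f x)).bilinearComp
        (fderivWithin ℝ (writtenInExtChartAt J I p f) (Set.range J) x)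
        (fderivWithin ℝ (writtenInExtChartAt J I p f) (Set.range J) x) := by
  have : IsManifold J 2 P := IsManifold.of_le (n := ∞) ENat.LEInfty.out
  have : IsManifold I 2 Q := IsManifold.of_le (n := ∞) ENat.LEInfty.out
  have : IsManifold J 1 P := IsManifold.of_le (n := ∞) ENat.LEInfty.out
  have : IsManifold I 1 Q := IsManifold.of_le (n := ∞) ENat.LEInfty.out
  have e1 : ∀ᶠ q in 𝓝 p, ContMDiffAt J I 2 f q := (contMDiffAt_iff_contMDiffAt_nhds (by norm_num)).1 hf
  have e2 : ∀ᶠ q in 𝓝 p, f q ∈ (chartAt H (f p)).source :=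
    hf.continuousAt.eventually (chart_source_mem_nhds H (f p))
  have hc : Filter.Tendsto (extChartAt J p).symm (𝓝 (extChartAt J p p)) (𝓝 p) := by
    have := continuousAt_extChartAt_symm (I := J) p
    rwa [ContinuousAt, extChartAt_to_inv] at this
  have e3 := (e1.and e2).eventually_nhds
  have e4 := (hc.eventually e3).filter_mono (nhdsWithin_le_nhds (s := Set.range J))
  have e5 : ∀ᶠ x in 𝓝[Set.range J] (extChartAt J p p), x ∈ (extChartAt J p).target :=
    extChartAt_target_mem_nhdsWithin p
  filter_upwards [e4, e5] with x hx hxt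
  have hxR : x ∈ Set.range J := extChartAt_target_subset_range p hxt
  have hψ := mdifferentiableWithinAt_extChartAt_symm (I := J) hxt
  have hfx : MDifferentiableAt J I f ((extChartAt J p).symm x) :=
    hx.self_of_nhds.1.mdifferentiableAt two_ne_zero
  have huniq : UniqueMDiffWithinAt 𝓘(ℝ, E') (Set.range J) x :=
    (J.uniqueDiffOn x hxR).uniqueMDiffWithinAt
  have hfψ := hfx.comp_mdifferentiableWithinAt x hψ
  have hFm : MDifferentiableWithinAt 𝓘(ℝ, E') 𝓘(ℝ, E) (writtenInExtChartAt J I p f)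
      (Set.range J) x :=
    (mdifferentiableAt_extChartAt (I := I) hx.self_of_nhds.2).comp_mdifferentiableWithinAt x hfψ
  have hFt : writtenInExtChartAt J I p f x ∈ (extChartAt I (f p)).target := by
    apply (extChartAt I (f p)).map_source
    rw [extChartAt_source]
    exact hx.self_of_nhds.2
  have hback : (extChartAt I (f p)).symm (writtenInExtChartAt J I p f x) =
      f ((extChartAt J p).symm x) := by
    apply (extChartAt I (f p)).left_inv
    rw [extChartAt_source]
    exact hx.self_of_nhds.2
  -- The map `f ∘ (extChartAt J p).symm` also factors, near `x`, as the inverse chart of `Q` after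
  -- the coordinate representation of `f`. Equating the two chain rules gives `key`.
  have hc1 : mfderivWithin 𝓘(ℝ, E') I (f ∘ (extChartAt J p).symm) (Set.range J) x =
      (dmap J I f ((extChartAt J p).symm x)).comp (chartFrame J p x) :=
    mfderiv_comp_mfderivWithin x hfx hψ huniq
  have hc2 : mfderivWithin 𝓘(ℝ, E') I
      ((extChartAt I (f p)).symm ∘ writtenInExtChartAt J I p f) (Set.range J) x =
      (chartFrame I (f p) (writtenInExtChartAt J I p f x)).comp
        (mfderivWithin 𝓘(ℝ, E') 𝓘(ℝ, E) (writtenInExtChartAt J I p f) (Set.range J) x) :=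
    mfderivWithin_comp x (mdifferentiableWithinAt_extChartAt_symm (I := I) hFt) hFm
      (mapsTo_writtenInExtChartAt f p _) huniq
  have heq : (extChartAt I (f p)).symm ∘ writtenInExtChartAt J I p f
      =ᶠ[𝓝[Set.range J] x] f ∘ (extChartAt J p).symm := by
    have hcx : ContinuousWithinAt (extChartAt J p).symm (Set.range J) x :=
      hψ.continuousWithinAt
    filter_upwards [hcx.eventually hx] with y hy
    apply (extChartAt I (f p)).left_inv
    rw [extChartAt_source]
    exact hy.2
  have hc3 := heq.mfderivWithin_eq_of_mem (I := 𝓘(ℝ, E')) (I' := I) hxR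
  rw [mfderivWithin_eq_fderivWithin] at hc2
  have key : ∀ v : E', chartFrame I (f p) (writtenInExtChartAt J I p f x)
      (fderivWithin ℝ (writtenInExtChartAt J I p f) (Set.range J) x v) =
      dmap J I f ((extChartAt J p).symm x) (chartFrame J p x v) := by
    intro v
    have h1 : mfderivWithin 𝓘(ℝ, E') I (f ∘ (extChartAt J p).symm) (Set.range J) x v =
      dmap J I f ((extChartAt J p).symm x) (chartFrame J p x v) := by rw [hc1]; rfl
    have h2 : mfderivWithin 𝓘(ℝ, E') I
      ((extChartAt I (f p)).symm ∘ writtenInExtChartAt J I p f) (Set.range J) x v =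
      chartFrame I (f p) (writtenInExtChartAt J I p f x)
      (fderivWithin ℝ (writtenInExtChartAt J I p f) (Set.range J) x v) := by rw [hc2]; rfl
    rw [← h1, ← h2]
    exact congrArg (fun L : E' →L[ℝ] E => L v) hc3
  ext v w
  simp only [coordBilin, pullbackBilin, ContinuousLinearMap.bilinearComp_apply, hback, key]

/-- Evaluation at `v`, `w` commutes with differentiation. This makes `coordDeriv` trilinear wherever
the coordinate metric is differentiable. -/
theorem coordDeriv_eq {B : BilinField E Q} {p : Q}
    (hB : DifferentiableWithinAt ℝ (coordBilin I B p) (Set.range I) (extChartAt I p p))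
    (u v w : E) :
    coordDeriv I B p u v w =
      fderivWithin ℝ (coordBilin I B p) (Set.range I) (extChartAt I p p) u v w := by
  have hx : UniqueDiffWithinAt ℝ (Set.range I) (extChartAt I p p) :=
    I.uniqueDiffOn _ (extChartAt_target_subset_range p (mem_extChartAt_target p))
  have h := (hB.hasFDerivWithinAt.clm_apply (hasFDerivWithinAt_const v _ _)).clm_apply
    (hasFDerivWithinAt_const w _ _)
  rw [coordDeriv, h.fderivWithin hx]
  simp

/-- Tangent vectors at `p` are components in the preferred chart at `p`, so at the base point the
frame is the derivative of that chart composed with its own inverse. -/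
theorem chartFrame_extChartAt [IsManifold I ∞ Q] (p : Q) :
    chartFrame I p (extChartAt I p p) = ContinuousLinearMap.id ℝ E := by
  have : IsManifold I 1 Q := IsManifold.of_le (n := ∞) ENat.LEInfty.out
  have hm := mdifferentiableWithinAt_extChartAt_symm (I := I) (mem_extChartAt_target (I := I) p)
  have hx : UniqueDiffWithinAt ℝ (Set.range I) (extChartAt I p p) :=
    I.uniqueDiffOn _ (extChartAt_target_subset_range p (mem_extChartAt_target p))
  have h1 : chartFrame I p (extChartAt I p p) = fderivWithin ℝ
      (extChartAt I ((extChartAt I p).symm (extChartAt I p p)) ∘ (extChartAt I p).symm)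
      (Set.range I) (extChartAt I p p) := by
    unfold chartFrame mfderivWithin
    refine (if_pos hm).trans ?_
    have hs : (extChartAt 𝓘(ℝ, E) (extChartAt I p p)).symm ⁻¹' Set.range I ∩ Set.range 𝓘(ℝ, E) =
        Set.range I := by
      rw [modelWithCornersSelf_coe, Set.range_id, Set.inter_univ]
      rfl
    rw [hs]
    rfl
  have h2 : extChartAt I p ∘ (extChartAt I p).symm =ᶠ[𝓝[Set.range I] (extChartAt I p p)] id := by
    filter_upwards [extChartAt_target_mem_nhdsWithin p] with x hx
    exact (extChartAt I p).right_inv hx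
  rw [h1, extChartAt_to_inv, h2.fderivWithin_eq (by simp), fderivWithin_id hx]

theorem coordBilin_extChartAt [IsManifold I ∞ Q] (B : BilinField E Q) (p : Q) :
    coordBilin I B p (extChartAt I p p) = B p := by
  ext v w
  rw [coordBilin, chartFrame_extChartAt, extChartAt_to_inv]
  rfl

/-- Product rule for `B(F)(DF v, DF w)`: one term differentiates `B`, the other two produce the
Hessian of `f`. -/
theorem coordDeriv_pullbackBilin [IsManifold J ∞ P] [IsManifold I ∞ Q]
    {B : BilinField E Q} {f : P → Q} {p : P}
    (hB : DifferentiableWithinAt ℝ (coordBilin I B (f p)) (Set.range I) (extChartAt I (f p) (f p)))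
    (hf : ContMDiffAt J I 2 f p) (u v w : E') :
    coordDeriv J (pullbackBilin J I f B) p u v w =
      coordDeriv I B (f p) (dmap J I f p u) (dmap J I f p v) (dmap J I f p w) +
        B (f p) (coordHess J I f p u v) (dmap J I f p w) +
        B (f p) (dmap J I f p v) (coordHess J I f p u w) := by
  have hx : extChartAt J p p ∈ Set.range J :=
    extChartAt_target_subset_range p (mem_extChartAt_target p)
  have h1 : (fun x => coordBilin J (pullbackBilin J I f B) p x v w)
      =ᶠ[𝓝[Set.range J] (extChartAt J p p)] fun x =>
      coordBilin I B (f p) (writtenInExtChartAt J I p f x)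
        (fderivWithin ℝ (writtenInExtChartAt J I p f) (Set.range J) x v)
        (fderivWithin ℝ (writtenInExtChartAt J I p f) (Set.range J) x w) := by
    filter_upwards [coordBilin_pullbackBilin B hf] with x hx
    rw [hx]
    rfl
  rw [coordDeriv_eq hB, coordDeriv, h1.fderivWithin_eq_of_mem hx,
    fderivWithin_bilin_comp (R' := Set.range I) (by rwa [writtenInExtChartAt_self])
      (contDiffWithinAt_writtenInExtChartAt hf) J.uniqueDiffOn hx
      (mapsTo_writtenInExtChartAt f p _),
    writtenInExtChartAt_self, coordBilin_extChartAt,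
    dmap_eq_fderivWithin (hf.mdifferentiableAt two_ne_zero)]
  rfl

/-- Symmetry of second derivatives persists at boundary points, since the range of a model with
corners lies in the closure of its interior. The boundary case is needed for `j` on `∂Ω`. -/
theorem coordHess_symm {f : P → Q} {p : P} (hf : ContMDiffAt J I 2 f p) (u v : E') :
    coordHess J I f p u v = coordHess J I f p v u := by
  have hx : extChartAt J p p ∈ Set.range J :=
    extChartAt_target_subset_range p (mem_extChartAt_target p)
  have h := (contDiffWithinAt_writtenInExtChartAt hf).isSymmSndFDerivWithinAt
    (by simp) J.uniqueDiffOn (J.range_subset_closure_interior hx) hx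
  exact h u v

/-- The Christoffel symbols of a pullback. -/
theorem christoffelFirst_pullbackBilin [IsManifold J ∞ P] [IsManifold I ∞ Q]
    {B : BilinField E Q} {f : P → Q} {p : P}
    (hB : DifferentiableWithinAt ℝ (coordBilin I B (f p)) (Set.range I) (extChartAt I (f p) (f p)))
    (hsymm : ∀ v w, B (f p) v w = B (f p) w v)
    (hf : ContMDiffAt J I 2 f p) (u v w : E') :
    christoffelFirst J (pullbackBilin J I f B) p u v w =
      christoffelFirst I B (f p) (dmap J I f p u) (dmap J I f p v) (dmap J I f p w) +
        B (f p) (coordHess J I f p u v) (dmap J I f p w) := by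
  simp only [christoffelFirst, coordDeriv_pullbackBilin hB hf]
  -- Of the six Hessian terms, four cancel in pairs and the two equal to `B(Hess(u,v), df w)`
  -- survive, absorbing the factor `1/2`.
  rw [coordHess_symm hf v u, coordHess_symm hf w u, coordHess_symm hf w v,
    hsymm (dmap J I f p v), hsymm (dmap J I f p u)]
  ring

theorem coordHess_comp {f : P → Q} {g : S → P} {s : S}
    (hf : ContMDiffAt J I 2 f (g s)) (hg : ContMDiffAt K J 2 g s) (u v : E'') :
    coordHess K I (f ∘ g) s u v =
      coordHess J I f (g s) (dmap K J g s u) (dmap K J g s v) +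
        dmap J I f (g s) (coordHess K J g s u v) := by
  have hx : extChartAt K s s ∈ Set.range K :=
    extChartAt_target_subset_range s (mem_extChartAt_target s)
  have hev : writtenInExtChartAt K I s (f ∘ g) =ᶠ[𝓝[Set.range K] (extChartAt K s s)]
      writtenInExtChartAt J I (g s) f ∘ writtenInExtChartAt K J s g := by
    have hc : Filter.Tendsto (extChartAt K s).symm (𝓝 (extChartAt K s s)) (𝓝 s) := by
      have := continuousAt_extChartAt_symm (I := K) s
      rwa [ContinuousAt, extChartAt_to_inv] at this
    have e : ∀ᶠ q in 𝓝 s, g q ∈ (extChartAt J (g s)).source :=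
      hg.continuousAt.eventually (extChartAt_source_mem_nhds (g s))
    filter_upwards [(hc.eventually e).filter_mono nhdsWithin_le_nhds] with x hx
    simp only [writtenInExtChartAt, Function.comp_apply]
    rw [(extChartAt J (g s)).left_inv hx]
  have hF := contDiffWithinAt_writtenInExtChartAt hf
  have h1 : fderivWithin ℝ (writtenInExtChartAt K I s (f ∘ g)) (Set.range K)
      =ᶠ[𝓝[Set.range K] (extChartAt K s s)] fderivWithin ℝ
        (writtenInExtChartAt J I (g s) f ∘ writtenInExtChartAt K J s g) (Set.range K) :=
    hev.fderivWithin
  rw [coordHess, h1.fderivWithin_eq_of_mem hx,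
    fderivWithin_fderivWithin_comp (R := Set.range J) (by rwa [writtenInExtChartAt_self])
      (contDiffWithinAt_writtenInExtChartAt hg) K.uniqueDiffOn hx J.uniqueDiffOn
      (mapsTo_writtenInExtChartAt g s _), writtenInExtChartAt_self,
    dmap_eq_fderivWithin (hf.mdifferentiableAt two_ne_zero),
    dmap_eq_fderivWithin (hg.mdifferentiableAt two_ne_zero)]
  rfl

/-- The second fundamental form of `g` with respect to the metric `f^* B` is the one of `f ∘ g` with
respect to `B`. -/
theorem secondForm_pullbackBilin [IsManifold J ∞ P] [IsManifold I ∞ Q]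
    {B : BilinField E Q} {f : P → Q} {g : S → P}
    {s : S}
    (hB : DifferentiableWithinAt ℝ (coordBilin I B (f (g s))) (Set.range I)
      (extChartAt I (f (g s)) (f (g s))))
    (hsymm : ∀ v w, B (f (g s)) v w = B (f (g s)) w v)
    (hf : ContMDiffAt J I 2 f (g s)) (hg : ContMDiffAt K J 2 g s) (u v : E'') (n : E') :
    secondForm K J (pullbackBilin J I f B) g s u v n =
      secondForm K I B (f ∘ g) s u v (dmap J I f (g s) n) := by
  have hf' := hf.mdifferentiableAt two_ne_zero
  have hg' := hg.mdifferentiableAt two_ne_zero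
  simp only [secondForm, christoffelFirst_pullbackBilin hB hsymm hf, coordHess_comp hf hg,
    dmap_comp hf' hg', map_add, add_apply, Function.comp_apply]
  simp only [pullbackBilin, ContinuousLinearMap.bilinearComp_apply]
  ring

/-- The coordinate expression of a pullback is differentiable. -/
theorem differentiableWithinAt_coordBilin_pullbackBilin [IsManifold J ∞ P] [IsManifold I ∞ Q]
    {B : BilinField E Q} {f : P → Q} {p : P}
    (hB : DifferentiableWithinAt ℝ (coordBilin I B (f p)) (Set.range I) (extChartAt I (f p) (f p)))
    (hf : ContMDiffAt J I 2 f p) :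
    DifferentiableWithinAt ℝ (coordBilin J (pullbackBilin J I f B) p) (Set.range J)
      (extChartAt J p p) := by
  have hx : extChartAt J p p ∈ Set.range J :=
    extChartAt_target_subset_range p (mem_extChartAt_target p)
  have hF := contDiffWithinAt_writtenInExtChartAt hf
  have hD := hF.differentiableWithinAt_fderivWithin J.uniqueDiffOn hx
  have hB' : DifferentiableWithinAt ℝ (coordBilin I B (f p)) (Set.range I)
      (writtenInExtChartAt J I p f (extChartAt J p p)) := by
    rwa [writtenInExtChartAt_self]
  have hc : DifferentiableWithinAt ℝ (coordBilin I B (f p) ∘ writtenInExtChartAt J I p f)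
      (Set.range J) (extChartAt J p p) :=
    DifferentiableWithinAt.comp (g := coordBilin I B (f p)) _ hB' (hF.differentiableWithinAt two_ne_zero) (mapsTo_writtenInExtChartAt f p _)
  have h2 := hc.bilinearComp hD
  exact h2.congr_of_eventuallyEq_of_mem (coordBilin_pullbackBilin B hf) hx

/-- If two metrics agree along `f`, then so do their derivatives in directions tangent to `f`. -/
theorem coordDeriv_eq_of_eq_along {B B' : BilinField E Q} {f : P → Q} {p : P}
    (hB : DifferentiableWithinAt ℝ (coordBilin I B (f p)) (Set.range I) (extChartAt I (f p) (f p)))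
    (hB' : DifferentiableWithinAt ℝ (coordBilin I B' (f p)) (Set.range I)
      (extChartAt I (f p) (f p)))
    (hf : ContMDiffAt J I 2 f p) (h : ∀ q, B (f q) = B' (f q)) (u : E') (v w : E) :
    coordDeriv I B (f p) (dmap J I f p u) v w = coordDeriv I B' (f p) (dmap J I f p u) v w := by
  have hx : extChartAt J p p ∈ Set.range J :=
    extChartAt_target_subset_range p (mem_extChartAt_target p)
  have hF := ((contDiffWithinAt_writtenInExtChartAt hf).differentiableWithinAt
    two_ne_zero).hasFDerivWithinAt
  -- By the chain rule the derivative in a direction `df u` is a derivative of the coordinate metric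
  -- restricted to the image of `f`, so it depends only on the values along `f`.
  have key : ∀ C : BilinField E Q, DifferentiableWithinAt ℝ (coordBilin I C (f p)) (Set.range I)
      (extChartAt I (f p) (f p)) → coordDeriv I C (f p) (dmap J I f p u) v w =
      fderivWithin ℝ (fun x => coordBilin I C (f p) (writtenInExtChartAt J I p f x))
        (Set.range J) (extChartAt J p p) u v w := by
    intro C hC
    rw [coordDeriv_eq hC, dmap_eq_fderivWithin (hf.mdifferentiableAt two_ne_zero)]
    have hC' : HasFDerivWithinAt (coordBilin I C (f p)) (fderivWithin ℝ (coordBilin I C (f p))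
      (Set.range I) (extChartAt I (f p) (f p))) (Set.range I)
        (writtenInExtChartAt J I p f (extChartAt J p p)) := by
      rw [writtenInExtChartAt_self]
      exact hC.hasFDerivWithinAt
    have h1 := (HasFDerivWithinAt.comp (g := coordBilin I C (f p)) _ hC' hF (mapsTo_writtenInExtChartAt f p _)).fderivWithin
      (J.uniqueDiffOn _ hx)
    simp only [Function.comp_def] at h1
    rw [h1]
    rfl
  rw [key B hB, key B' hB']
  have hc : Filter.Tendsto (extChartAt J p).symm (𝓝 (extChartAt J p p)) (𝓝 p) := by
    have := continuousAt_extChartAt_symm (I := J) p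
    rwa [ContinuousAt, extChartAt_to_inv] at this
  have e : ∀ᶠ q in 𝓝 p, f q ∈ (extChartAt I (f p)).source :=
    hf.continuousAt.eventually (extChartAt_source_mem_nhds (f p))
  have h2 : (fun x => coordBilin I B (f p) (writtenInExtChartAt J I p f x))
      =ᶠ[𝓝[Set.range J] (extChartAt J p p)]
      fun x => coordBilin I B' (f p) (writtenInExtChartAt J I p f x) := by
    filter_upwards [(hc.eventually e).filter_mono nhdsWithin_le_nhds] with x hx
    have hb : (extChartAt I (f p)).symm (writtenInExtChartAt J I p f x) =
        f ((extChartAt J p).symm x) := (extChartAt I (f p)).left_inv hx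
    simp only [coordBilin, hb, h]
  rw [h2.fderivWithin_eq_of_mem hx]

end Pullback

/-! ## Linear algebra of adapted frames -/

section Frames

theorem stdVec_apply {n : ℕ} (i k : Fin n) : (stdVec i : Eu n) k = if k = i then 1 else 0 := by
  simp [stdVec, PiLp.single_apply]

theorem sum_smul_stdVec {n : ℕ} (x : Eu n) : ∑ i, x i • (stdVec i : Eu n) = x := by
  ext k
  simp [stdVec_apply]

theorem map_eq_sum_stdVec {n : ℕ} {F : Type*} [AddCommGroup F] [Module ℝ F] (L : Eu n →ₗ[ℝ] F)
    (x : Eu n) : L x = ∑ i, x i • L (stdVec i) := by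
  conv_lhs => rw [← sum_smul_stdVec x]
  simp

/-- The matrix of a bilinear form in the standard basis. -/
noncomputable def bilinMatrix {n : ℕ} (L : Eu n →ₗ[ℝ] Eu n →ₗ[ℝ] ℝ) : Matrix (Fin n) (Fin n) ℝ :=
  Matrix.of fun i k => L (stdVec i) (stdVec k)

/-- The matrix whose columns are the given vectors. -/
def colMatrix {n : ℕ} (T : Fin n → Eu n) : Matrix (Fin n) (Fin n) ℝ :=
  Matrix.of fun a i => T i a

theorem transpose_colMatrix_mul {n : ℕ} (T : Fin n → Eu n) (L : Eu n →ₗ[ℝ] Eu n →ₗ[ℝ] ℝ) :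
    (colMatrix T).transpose * bilinMatrix L * colMatrix T = Matrix.of fun i k => L (T i) (T k) := by
  ext i k
  rw [Matrix.of_apply, map_eq_sum_stdVec L (T i), LinearMap.sum_apply]
  simp only [Matrix.mul_apply, Finset.sum_mul, Matrix.transpose_apply, colMatrix, bilinMatrix,
    Matrix.of_apply, LinearMap.smul_apply]
  rw [Finset.sum_comm]
  refine Finset.sum_congr rfl fun a _ => ?_
  rw [map_eq_sum_stdVec (L (stdVec a)) (T k), Finset.smul_sum]
  refine Finset.sum_congr rfl fun b _ => ?_
  simp only [smul_eq_mul]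
  ring

/-- With `P` the matrix of a frame and `A` its Gram matrix, this expands the inverse metric in the
frame: `g⁻¹ = ∑ H^{ik} T_i ⊗ T_k`. -/
theorem inv_eq_mul_mul_transpose {n : ℕ} {G P A H : Matrix (Fin n) (Fin n) ℝ}
    (hA : P.transpose * G * P = A) (hH : A * H = 1) :
    P.det ≠ 0 ∧ G⁻¹ = P * H * P.transpose := by
  have hdet : A.det ≠ 0 := by
    intro h
    have := congrArg Matrix.det hH
    rw [Matrix.det_mul, h, zero_mul, Matrix.det_one] at this
    exact zero_ne_one this
  have hP : P.det ≠ 0 := by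
    intro h
    apply hdet
    rw [← hA, Matrix.det_mul, h, mul_zero]
  refine ⟨hP, Matrix.inv_eq_right_inv ?_⟩
  have hPt : IsUnit P.transpose := by
    rw [Matrix.isUnit_iff_isUnit_det, Matrix.det_transpose]
    exact hP.isUnit
  apply hPt.mul_left_cancel
  calc P.transpose * (G * (P * H * P.transpose)) = (P.transpose * G * P) * H * P.transpose := by
        simp only [Matrix.mul_assoc]
    _ = P.transpose * 1 := by rw [hA, hH, Matrix.one_mul, Matrix.mul_one]

/-- The left side is the shape in which `ω^a_b ∧ i_N η_a^b` arises; as a trace it can be moved to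
another frame. -/
theorem sum_sum_mul_eq_trace {n : ℕ} (K L M : Matrix (Fin n) (Fin n) ℝ) :
    ∑ a, ∑ b, (∑ d, K a d * L b d) * (∑ β, K b β * M a β) =
      (K * L.transpose * (K * M.transpose)).trace := by
  simp [Matrix.trace, Matrix.mul_apply]

/-- The contraction of two bilinear forms by the inverse metric may be computed in any frame. -/
theorem trace_contraction {n : ℕ} {K H : Matrix (Fin n) (Fin n) ℝ} {T : Fin n → Eu n}
    (hK : K = colMatrix T * H * (colMatrix T).transpose) (L M : Eu n →ₗ[ℝ] Eu n →ₗ[ℝ] ℝ) :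
    (K * (bilinMatrix L).transpose * (K * (bilinMatrix M).transpose)).trace =
      (H * (Matrix.of fun i k => L (T k) (T i)) * (H * Matrix.of fun i k => M (T k) (T i))).trace := by
  have h1 : ∀ L : Eu n →ₗ[ℝ] Eu n →ₗ[ℝ] ℝ, (Matrix.of fun i k => L (T k) (T i)) =
      (colMatrix T).transpose * (bilinMatrix L).transpose * colMatrix T := by
    intro L
    have := congrArg Matrix.transpose (transpose_colMatrix_mul T L)
    rw [Matrix.transpose_mul, Matrix.transpose_mul, Matrix.transpose_transpose] at this
    rw [Matrix.mul_assoc, this]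
    rfl
  rw [h1 L, h1 M, hK]
  simp only [Matrix.mul_assoc]
  rw [Matrix.trace_mul_comm]
  simp only [Matrix.mul_assoc]

/-- The explicit expansion reduces multilinearity and evaluation on frames to polynomial identities.
-/
theorem det_rows_four (v : Fin 4 → Eu 4) :
    (Matrix.of fun i k => v i k).det =
      v 0 0 * (v 1 1 * (v 2 2 * v 3 3 - v 2 3 * v 3 2) - v 1 2 * (v 2 1 * v 3 3 - v 2 3 * v 3 1) +
        v 1 3 * (v 2 1 * v 3 2 - v 2 2 * v 3 1)) -
      v 0 1 * (v 1 0 * (v 2 2 * v 3 3 - v 2 3 * v 3 2) - v 1 2 * (v 2 0 * v 3 3 - v 2 3 * v 3 0) +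
        v 1 3 * (v 2 0 * v 3 2 - v 2 2 * v 3 0)) +
      v 0 2 * (v 1 0 * (v 2 1 * v 3 3 - v 2 3 * v 3 1) - v 1 1 * (v 2 0 * v 3 3 - v 2 3 * v 3 0) +
        v 1 3 * (v 2 0 * v 3 1 - v 2 1 * v 3 0)) -
      v 0 3 * (v 1 0 * (v 2 1 * v 3 2 - v 2 2 * v 3 1) - v 1 1 * (v 2 0 * v 3 2 - v 2 2 * v 3 0) +
        v 1 2 * (v 2 0 * v 3 1 - v 2 1 * v 3 0)) := by
  simp [Matrix.det_succ_row_zero, Fin.sum_univ_succ, Fin.succAbove]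
  ring

/-- The determinant, as a bilinear form in its first two rows. -/
noncomputable def detBilin (N V : Eu 4) : Eu 4 →ₗ[ℝ] Eu 4 →ₗ[ℝ] ℝ :=
  LinearMap.mk₂ ℝ (fun x y => (Matrix.of fun i k => (![x, y, N, V] : Fin 4 → Eu 4) i k).det)
    (by intros; simp only [det_rows_four]; simp; ring)
    (by intros; simp only [det_rows_four]; simp; ring)
    (by intros; simp only [det_rows_four]; simp; ring)
    (by intros; simp only [det_rows_four]; simp; ring)

theorem detBilin_apply (N V x y : Eu 4) :
    detBilin N V x y = (Matrix.of fun i k => (![x, y, N, V] : Fin 4 → Eu 4) i k).det := rfl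

/-- A frame `N, n, t 0, t 1` with `N`, `n` unit normals (`N` timelike) to the `t i`. -/
structure IsAdaptedFrame (G : Eu 4 →L[ℝ] Eu 4 →L[ℝ] ℝ) (N n : Eu 4) (t : Fin 2 → Eu 4) : Prop where
  symm : ∀ u v, G u v = G v u
  timelike : G N N = -1
  spacelike : G n n = 1
  orthogonal : G N n = 0
  orthogonal_left (i) : G N (t i) = 0
  orthogonal_right (i) : G n (t i) = 0
  det_pos : 0 < (Matrix.of fun i k => G (t i) (t k)).det

variable {G : Eu 4 →L[ℝ] Eu 4 →L[ℝ] ℝ} {N n : Eu 4} {t : Fin 2 → Eu 4}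

namespace IsAdaptedFrame

theorem gram_frame (hT : IsAdaptedFrame G N n t) :
    (Matrix.of fun i k => G (![N, n, t 0, t 1] i) (![N, n, t 0, t 1] k)) =
      !![-1, 0, 0, 0; 0, 1, 0, 0; 0, 0, G (t 0) (t 0), G (t 0) (t 1);
        0, 0, G (t 1) (t 0), G (t 1) (t 1)] := by
  ext i k
  fin_cases i <;> fin_cases k <;>
    simp [hT.timelike, hT.spacelike, hT.orthogonal, hT.orthogonal_left, hT.orthogonal_right,
      hT.symm n N, hT.symm (t _) N, hT.symm (t _) n]

/-- The Gram matrix is block diagonal with blocks `-1`, `1` and `h`, so it is inverted block by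
block. -/
theorem frame_mul_inv (hT : IsAdaptedFrame G N n t) (h : Matrix (Fin 2) (Fin 2) ℝ)
    (hh : h = Matrix.of fun i k => G (t i) (t k)) :
    (Matrix.of fun i k => G (![N, n, t 0, t 1] i) (![N, n, t 0, t 1] k)) *
      !![-1, 0, 0, 0; 0, 1, 0, 0; 0, 0, h⁻¹ 0 0, h⁻¹ 0 1; 0, 0, h⁻¹ 1 0, h⁻¹ 1 1] = 1 := by
  have h1 : h * h⁻¹ = 1 := by
    apply Matrix.mul_nonsing_inv
    rw [hh]
    exact hT.det_pos.ne'.isUnit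
  have e : ∀ i k, h i 0 * h⁻¹ 0 k + h i 1 * h⁻¹ 1 k = (1 : Matrix (Fin 2) (Fin 2) ℝ) i k := by
    intro i k
    rw [← h1, Matrix.mul_apply, Fin.sum_univ_two]
  have hk : ∀ i k, G (t i) (t k) = h i k := by intro i k; rw [hh]; rfl
  have e00 := e 0 0
  have e01 := e 0 1
  have e10 := e 1 0
  have e11 := e 1 1
  simp at e00 e01 e10 e11
  rw [hT.gram_frame]
  simp only [hk]
  ext i k
  fin_cases i <;> fin_cases k <;> simp [Matrix.mul_apply, Fin.sum_univ_four, e00, e01, e10, e11]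

theorem det_gram_frame (hT : IsAdaptedFrame G N n t) :
    (Matrix.of fun i k => G (![N, n, t 0, t 1] i) (![N, n, t 0, t 1] k)).det =
      -(Matrix.of fun i k => G (t i) (t k)).det := by
  rw [hT.gram_frame, Matrix.det_fin_two]
  simp [Matrix.det_succ_row_zero, Fin.sum_univ_succ, Fin.succAbove]
  ring

/-- The contraction occurring in the Chen-Nester-Tung form, in an adapted frame. -/
theorem contraction (hT : IsAdaptedFrame G N n t) {K : Matrix (Fin 4) (Fin 4) ℝ}
    (hK : K = (Matrix.of fun a b => G (stdVec a) (stdVec b))⁻¹)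
    {h : Matrix (Fin 2) (Fin 2) ℝ} (hh : h = Matrix.of fun i k => G (t i) (t k))
    {L : Eu 4 →ₗ[ℝ] Eu 4 →ₗ[ℝ] ℝ} (hL : ∀ x y, L x y = -L y x) {V : Eu 4} {v : Fin 2 → ℝ}
    (hV : V = v 0 • t 0 + v 1 • t 1) :
    ∑ a, ∑ b, (∑ d, K a d * L (stdVec b) (stdVec d)) *
        (∑ β, K b β * detBilin N V (stdVec a) (stdVec β)) =
      2 * (Matrix.of fun i k => (![N, n, t 0, t 1] : Fin 4 → Eu 4) i k).det *
        (v 1 * (h⁻¹ 0 0 * L (t 0) n + h⁻¹ 0 1 * L (t 1) n) -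
          v 0 * (h⁻¹ 1 0 * L (t 0) n + h⁻¹ 1 1 * L (t 1) n)) := by
  have hsymm : ∀ i k, h⁻¹ i k = h⁻¹ k i := by
    have : h.transpose = h := by
      ext i k
      rw [hh]
      exact hT.symm _ _
    intro i k
    conv_lhs => rw [← this, ← Matrix.transpose_nonsing_inv]
    rfl
  have hinv := (inv_eq_mul_mul_transpose (P := colMatrix ![N, n, t 0, t 1])
    (transpose_colMatrix_mul ![N, n, t 0, t 1] G.toLinearMap₁₂) (hT.frame_mul_inv h hh)).2
  have hK' := hK.trans hinv
  have h1 := sum_sum_mul_eq_trace K (bilinMatrix L) (bilinMatrix (detBilin N V))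
  rw [trace_contraction hK' L (detBilin N V)] at h1
  refine Eq.trans h1 ?_
  -- Since `N` is already inserted and `V` lies in the span of the `t i`, the determinant survives
  -- only on pairs of `n` with some `t i`. Each pair occurs in both orders, and both forms are skew,
  -- whence the factor `2`.
  have hM : (Matrix.of fun i k => detBilin N V (![N, n, t 0, t 1] k) (![N, n, t 0, t 1] i)) =
      (Matrix.of fun i k => (![N, n, t 0, t 1] : Fin 4 → Eu 4) i k).det •
        !![0, 0, 0, 0; 0, 0, -v 1, v 0; 0, v 1, 0, 0; 0, -v 0, 0, 0] := by
    ext i k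
    simp only [detBilin_apply, det_rows_four, hV, Matrix.of_apply, Matrix.smul_apply]
    fin_cases i <;> fin_cases k <;> simp <;> ring
  rw [hM]
  generalize (Matrix.of fun i k => (![N, n, t 0, t 1] : Fin 4 → Eu 4) i k).det = W
  simp only [Matrix.trace, Matrix.diag, Matrix.mul_apply, Fin.sum_univ_four, Matrix.of_apply,
    Matrix.smul_apply, smul_eq_mul]
  simp
  rw [hL n (t 0), hL n (t 1), hsymm 1 0]
  ring

end IsAdaptedFrame

end Frames

/-! ## The Chen-Nester-Tung form and the volume forms in an adapted frame -/

section Forms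

variable {n : ℕ} {Q : Type*} [TopologicalSpace Q] [ChartedSpace (Eu n) Q]

/-- The bilinear form `1/2 (D_x B(u, y) - D_y B(u, x))`. -/
noncomputable def skewDeriv {E H : Type*} [NormedAddCommGroup E] [NormedSpace ℝ E]
    [TopologicalSpace H] {Q : Type*} [TopologicalSpace Q] [ChartedSpace H Q]
    (I : ModelWithCorners ℝ E H) (B : BilinField E Q) (p : Q) (u : E) : E →ₗ[ℝ] E →ₗ[ℝ] ℝ :=
  let D : E →L[ℝ] E →L[ℝ] E →L[ℝ] ℝ :=
    fderivWithin ℝ (coordBilin I B p) (Set.range I) (extChartAt I p p)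
  LinearMap.mk₂ ℝ (fun x y => 1 / 2 * (D x u y - D y u x))
    (by intros; simp; ring) (by intros; simp; ring) (by intros; simp; ring) (by intros; simp; ring)

theorem skewDeriv_apply {E H : Type*} [NormedAddCommGroup E] [NormedSpace ℝ E]
    [TopologicalSpace H] {Q : Type*} [TopologicalSpace Q] [ChartedSpace H Q]
    {I : ModelWithCorners ℝ E H} {B : BilinField E Q} {p : Q}
    (hB : DifferentiableWithinAt ℝ (coordBilin I B p) (Set.range I) (extChartAt I p p))
    (u x y : E) :
    skewDeriv I B p u x y = 1 / 2 * (coordDeriv I B p x u y - coordDeriv I B p y u x) := by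
  rw [coordDeriv_eq hB, coordDeriv_eq hB]
  rfl

theorem skewDeriv_add_smul {E H : Type*} [NormedAddCommGroup E] [NormedSpace ℝ E]
    [TopologicalSpace H] {Q : Type*} [TopologicalSpace Q] [ChartedSpace H Q]
    (I : ModelWithCorners ℝ E H) (B : BilinField E Q) (p : Q) (a b : ℝ) (u v x y : E) :
    skewDeriv I B p (a • u + b • v) x y =
      a * skewDeriv I B p u x y + b * skewDeriv I B p v x y := by
  simp [skewDeriv]
  ring

/-- Of the three derivatives in a Christoffel symbol, `D_u B(v,w)` is the only one symmetric under
exchanging `v` and `w`, and it cancels by `hu`. -/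
theorem christoffelFirst_sub {E H : Type*} [NormedAddCommGroup E] [NormedSpace ℝ E]
    [TopologicalSpace H] {Q : Type*} [TopologicalSpace Q] [ChartedSpace H Q]
    {I : ModelWithCorners ℝ E H} {B B' : BilinField E Q} {p : Q}
    (hB : DifferentiableWithinAt ℝ (coordBilin I B p) (Set.range I) (extChartAt I p p))
    (hB' : DifferentiableWithinAt ℝ (coordBilin I B' p) (Set.range I) (extChartAt I p p))
    {u : E} (hu : ∀ v w, coordDeriv I B p u v w = coordDeriv I B' p u v w) (v w : E) :
    christoffelFirst I B p u v w - christoffelFirst I B' p u v w =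
      (skewDeriv I B p u - skewDeriv I B' p u) v w := by
  rw [LinearMap.sub_apply, LinearMap.sub_apply, skewDeriv_apply hB, skewDeriv_apply hB',
    christoffelFirst, christoffelFirst, hu v w]
  ring

theorem connForm_sub {B B' : BilinField (Eu n) Q} {p : Q} (h : B p = B' p) (a b : Fin n)
    (v : Eu n) :
    connForm B p a b v - connForm B' p a b v =
      ∑ d, (gram B p)⁻¹ a d * (christoffelFirst (𝓡 n) B p v (stdVec b) (stdVec d) -
        christoffelFirst (𝓡 n) B' p v (stdVec b) (stdVec d)) := by
  have hg : gram B' p = gram B p := by rw [gram, gram, h]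
  rw [connForm, connForm, hg, ← Finset.sum_sub_distrib]
  exact Finset.sum_congr rfl fun d _ => by ring

theorem volForm_congr {o : OrientationForm n Q} {B B' : BilinField (Eu n) Q} {p : Q}
    (h : B p = B' p) : volForm o B p = volForm o B' p := by
  funext v
  rw [volForm, volForm, gram, gram, h]

/-- `η` involves no derivative of the metric. This is what removes the `D̄N` term on `S`. -/
theorem eta_congr {M : Type*} [TopologicalSpace M] [ChartedSpace (Eu 4) M]
    {o : OrientationForm 4 M} {B B' : BilinField (Eu 4) M} {p : M} (h : B p = B' p) :
    Spacetime.eta o B p = Spacetime.eta o B' p := by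
  funext a b u v
  simp only [Spacetime.eta, volForm_congr h, gram, h]

variable {M : Type*} [TopologicalSpace M] [ChartedSpace (Eu 4) M] {o : OrientationForm 4 M}
  {B B' : BilinField (Eu 4) M} {p : M}

/-- The Chen-Nester-Tung form of two metrics that agree to first order along a surface. -/
theorem cntForm_eq_of_isAdaptedFrame {N : M → Eu 4} {n : Eu 4} {t : Fin 2 → Eu 4}
    (hB : DifferentiableWithinAt ℝ (coordBilin (𝓡 4) B p) (Set.range (𝓡 4)) (extChartAt (𝓡 4) p p))
    (hB' : DifferentiableWithinAt ℝ (coordBilin (𝓡 4) B' p) (Set.range (𝓡 4))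
      (extChartAt (𝓡 4) p p))
    (h : B p = B' p)
    (ht : ∀ a : Fin 2 → ℝ, ∀ v w, coordDeriv (𝓡 4) B p (a 0 • t 0 + a 1 • t 1) v w =
      coordDeriv (𝓡 4) B' p (a 0 • t 0 + a 1 • t 1) v w)
    (hT : IsAdaptedFrame (B p) (N p) n t) (u v : Fin 2 → ℝ) :
    Spacetime.cntForm o B B' N p (u 0 • t 0 + u 1 • t 1) (v 0 • t 0 + v 1 • t 1) =
      2 * (∑ i, ∑ k, (Matrix.of fun i k => B p (t i) (t k))⁻¹ i k *
        (christoffelFirst (𝓡 4) B p (t i) (t k) n - christoffelFirst (𝓡 4) B' p (t i) (t k) n)) *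
        ((u 0 * v 1 - u 1 * v 0) * volForm o B p ![N p, n, t 0, t 1]) := by
  set L : Eu 4 → (Eu 4 →ₗ[ℝ] Eu 4 →ₗ[ℝ] ℝ) := fun u =>
    skewDeriv (𝓡 4) B p u - skewDeriv (𝓡 4) B' p u with hLdef
  set κ : ℝ := (SignType.sign (o.form p stdVec) : ℝ) * √|(gram B p).det| with hκ
  have hc : ∀ (a : Fin 2 → ℝ) (x y : Eu 4),
      christoffelFirst (𝓡 4) B p (a 0 • t 0 + a 1 • t 1) x y -
        christoffelFirst (𝓡 4) B' p (a 0 • t 0 + a 1 • t 1) x y =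
      L (a 0 • t 0 + a 1 • t 1) x y := fun a x y =>
    christoffelFirst_sub hB hB' (ht a) x y
  have hct : ∀ (i : Fin 2) (x y : Eu 4), christoffelFirst (𝓡 4) B p (t i) x y -
      christoffelFirst (𝓡 4) B' p (t i) x y = L (t i) x y := by
    intro i x y
    have := hc (Pi.single i 1) x y
    fin_cases i <;> simpa using this
  have hskew : ∀ u x y, L u x y = -L u y x := by
    intro u x y
    simp only [hLdef, LinearMap.sub_apply, skewDeriv_apply hB, skewDeriv_apply hB']
    ring
  have hlin : ∀ (a : Fin 2 → ℝ) (x y : Eu 4), L (a 0 • t 0 + a 1 • t 1) x y =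
      a 0 * L (t 0) x y + a 1 * L (t 1) x y := by
    intro a x y
    simp only [hLdef, LinearMap.sub_apply, skewDeriv_add_smul]
    ring
  have hη : ∀ (a b : Fin 4) (V : Eu 4), Spacetime.eta o B p a b (N p) V =
      κ * ∑ β, (gram B p)⁻¹ b β * detBilin (N p) V (stdVec a) (stdVec β) := by
    intro a b V
    rw [Spacetime.eta, Finset.mul_sum]
    refine Finset.sum_congr rfl fun β _ => ?_
    rw [volForm, detBilin_apply]
    ring
  -- One half of the wedge product; the other half is obtained by exchanging the two tangent
  -- vectors.
  have key : ∀ a b : Fin 2 → ℝ, ∑ x, ∑ y,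
      (connForm B p x y (a 0 • t 0 + a 1 • t 1) - connForm B' p x y (a 0 • t 0 + a 1 • t 1)) *
        Spacetime.eta o B p x y (N p) (b 0 • t 0 + b 1 • t 1) = κ * (2 *
      (Matrix.of fun i k => (![N p, n, t 0, t 1] : Fin 4 → Eu 4) i k).det *
        (b 1 * ((Matrix.of fun i k => B p (t i) (t k))⁻¹ 0 0 *
              L (a 0 • t 0 + a 1 • t 1) (t 0) n +
            (Matrix.of fun i k => B p (t i) (t k))⁻¹ 0 1 *
              L (a 0 • t 0 + a 1 • t 1) (t 1) n) -
          b 0 * ((Matrix.of fun i k => B p (t i) (t k))⁻¹ 1 0 *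
              L (a 0 • t 0 + a 1 • t 1) (t 0) n +
            (Matrix.of fun i k => B p (t i) (t k))⁻¹ 1 1 *
              L (a 0 • t 0 + a 1 • t 1) (t 1) n))) := by
    intro a b
    rw [← hT.contraction (K := (gram B p)⁻¹) rfl rfl (hskew _) (rfl : b 0 • t 0 + b 1 • t 1 = _),
      Finset.mul_sum]
    refine Finset.sum_congr rfl fun x _ => ?_
    rw [Finset.mul_sum]
    refine Finset.sum_congr rfl fun y _ => ?_
    simp only [connForm_sub h, hη, hc]
    ring
  have hvol : volForm o B p ![N p, n, t 0, t 1] =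
    κ * (Matrix.of fun i k => (![N p, n, t 0, t 1] : Fin 4 → Eu 4) i k).det := rfl
  rw [Spacetime.cntForm]
  simp only [← eta_congr (o := o) h, sub_self, mul_zero, add_zero, Finset.sum_sub_distrib]
  rw [key, key, hvol]
  -- Expanding `L` linearly in its direction, antisymmetrization leaves `u 0 * v 1 - u 1 * v 0`
  -- times the full trace `∑ h^{ik} L(t_i)(t_k, n)`.
  simp only [hct, hlin, Fin.sum_univ_two]
  ring

/-- `N` and `n` are unit normals to the surface, so up to sign the 4-volume of the frame is the area
spanned by `t 0`, `t 1`. The two orientation hypotheses fix the sign whether the coordinate basis of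
the surface is positive or negative. -/
theorem volForm_surface {S : Type*} [TopologicalSpace S] [ChartedSpace (Eu 2) S]
    {o₂ : OrientationForm 2 S} {h : BilinField (Eu 2) S} {s : S} {N n : Eu 4}
    {t : Fin 2 → Eu 4} (hT : IsAdaptedFrame (B p) N n t)
    (hh : ∀ i k, h s (stdVec i) (stdVec k) = B p (t i) (t k))
    (ho : 0 < o₂.form s ![stdVec 0, stdVec 1] → 0 < o.form p ![N, n, t 0, t 1])
    (ho' : 0 < o₂.form s ![stdVec 1, stdVec 0] → 0 < o.form p ![N, n, t 1, t 0]) (u v : Eu 2) :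
    volForm o₂ h s ![u, v] = (u 0 * v 1 - u 1 * v 0) * volForm o B p ![N, n, t 0, t 1] := by
  set W := (Matrix.of fun i k => (![N, n, t 0, t 1] : Fin 4 → Eu 4) i k).det with hW
  -- Both sides are the determinant of the Gram matrix of the frame; the minus sign comes from the
  -- timelike `N`.
  have hdet : -(gram h s).det = (gram B p).det * W ^ 2 := by
    have h1 := congrArg Matrix.det
      (transpose_colMatrix_mul ![N, n, t 0, t 1] (B p).toLinearMap₁₂)
    rw [Matrix.det_mul, Matrix.det_mul] at h1
    have h2 : gram h s = Matrix.of fun i k => B p (t i) (t k) := by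
      ext i k
      exact hh i k
    have h3 : (colMatrix ![N, n, t 0, t 1]).transpose.det = W := rfl
    rw [h2, ← hT.det_gram_frame]
    refine h1.symm.trans ?_
    rw [← Matrix.det_transpose (colMatrix _), h3]
    change W * (gram B p).det * W = _
    ring
  have hpos : 0 < (gram h s).det := by
    have h2 : gram h s = Matrix.of fun i k => B p (t i) (t k) := by
      ext i k
      exact hh i k
    rw [h2]
    exact hT.det_pos
  have hsqrt : √|(gram h s).det| = √|(gram B p).det| * |W| := by
    rw [← abs_neg, hdet, abs_mul, Real.sqrt_mul (abs_nonneg _), abs_pow, Real.sqrt_sq (abs_nonneg _)]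
  have hform : o.form p ![N, n, t 0, t 1] = o.form p stdVec * W := by
    have h1 := (o.form p).eq_smul_basis_det (EuclideanSpace.basisFun (Fin 4) ℝ).toBasis
    have h2 := congrArg (fun f => f ![N, n, t 0, t 1]) h1
    have h3 : ⇑(EuclideanSpace.basisFun (Fin 4) ℝ).toBasis = (stdVec : Fin 4 → Eu 4) := by
      funext i
      simp [stdVec]
    rw [h3] at h2
    refine h2.trans ?_
    rw [AlternatingMap.smul_apply, smul_eq_mul, Module.Basis.det_apply, ← Matrix.det_transpose]
    rfl
  have hstd : ![stdVec 0, stdVec 1] = (stdVec : Fin 2 → Eu 2) := by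
    funext i
    fin_cases i <;> rfl
  have hswap2 : o₂.form s ![stdVec 1, stdVec 0] = -o₂.form s stdVec := by
    rw [← hstd]
    have := (o₂.form s).map_swap ![stdVec 0, stdVec 1] (i := 0) (j := 1) (by decide)
    rw [← this]
    congr 1
    funext i
    fin_cases i <;> rfl
  have hswap4 : o.form p ![N, n, t 1, t 0] = -o.form p ![N, n, t 0, t 1] := by
    have := (o.form p).map_swap ![N, n, t 0, t 1] (i := 2) (j := 3) (by decide)
    rw [← this]
    congr 1
    funext i
    fin_cases i <;> rfl
  have hne : o₂.form s stdVec ≠ 0 := by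
    intro h0
    apply o₂.ne_zero s
    have h1 := (o₂.form s).eq_smul_basis_det (EuclideanSpace.basisFun (Fin 2) ℝ).toBasis
    have h3 : ⇑(EuclideanSpace.basisFun (Fin 2) ℝ).toBasis = (stdVec : Fin 2 → Eu 2) := by
      funext i
      simp [stdVec]
    rw [h3, h0, zero_smul] at h1
    exact h1
  rw [hstd] at ho
  rw [hswap2, hswap4] at ho'
  have hsign : (SignType.sign (o₂.form s stdVec) : ℝ) * |W| =
      (SignType.sign (o.form p stdVec) : ℝ) * W := by
    have hs : SignType.sign (o₂.form s stdVec) = SignType.sign (o.form p ![N, n, t 0, t 1]) := by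
      rcases lt_or_gt_of_ne hne with hlt | hgt
      · rw [sign_neg hlt, sign_neg (by linarith [ho' (by linarith)])]
      · rw [sign_pos hgt, sign_pos (ho hgt)]
    rw [hs, hform, sign_mul, SignType.coe_mul, mul_assoc, sign_mul_abs]
  rw [volForm, volForm, hsqrt, Matrix.det_fin_two, ← hW]
  simp only [Matrix.of_apply, Matrix.cons_val_zero, Matrix.cons_val_one]
  linear_combination (√|(gram B p).det| * (u 0 * v 1 - u 1 * v 0)) * hsign

end Forms

/-! ### Homogeneity of the surface integral -/

section Integral

variable {S : Type*} [TopologicalSpace S] [ChartedSpace (Eu 2) S] [IsManifold (𝓡 2) ∞ S]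
  [CompactSpace S] [T2Space S]

/-- No integrability or finiteness is required: the default value `0` of integrals and of `finsum`
is compatible with scaling. -/
theorem formIntegral_const_mul (o : OrientationForm 2 S) (c : ℝ) (α : S → Eu 2 → Eu 2 → ℝ) :
    formIntegral o (fun s u v => c * α s u v) = c * formIntegral o α := by
  simp only [formIntegral]
  rw [← smul_eq_mul (a := c), smul_finsum]
  refine finsum_congr fun i => ?_
  rw [smul_eq_mul, ← MeasureTheory.integral_const_mul]
  congr 1
  funext x
  ring

end Integral

/-! ### Mean curvature as a trace, and constant metrics -/

section MeanCurvature

variable {S : Type*} [TopologicalSpace S] [ChartedSpace (Eu 2) S] {E H : Type*}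
  [NormedAddCommGroup E] [NormedSpace ℝ E] [TopologicalSpace H] {Q : Type*} [TopologicalSpace Q]
  [ChartedSpace H Q] {I : ModelWithCorners ℝ E H}

theorem meanCurvature_eq_secondForm {B : BilinField E Q} {f : S → Q} {n : S → E} {s : S}
    (hf : MDifferentiableAt (𝓡 2) I f s) :
    meanCurvature I B f n s = -∑ i, ∑ k,
      (Matrix.of fun i k => B (f s) (dmap (𝓡 2) I f s (stdVec i))
        (dmap (𝓡 2) I f s (stdVec k)))⁻¹ i k *
        secondForm (𝓡 2) I B f s (stdVec i) (stdVec k) (n s) := by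
  have hr : Set.range (𝓡 2) = Set.univ := ModelWithCorners.range_eq_univ _
  simp only [meanCurvature, secondForm, coordHess, dmap_eq_fderivWithin hf, hr, fderivWithin_univ,
    Finset.sum_neg_distrib]
  rfl

theorem christoffelFirst_const {n : ℕ} (G : Eu n →L[ℝ] Eu n →L[ℝ] ℝ) (p u v w : Eu n) :
    christoffelFirst (𝓡 n) (fun _ : Eu n => G) p u v w = 0 := by
  have h : ∀ x, coordBilin (𝓡 n) (fun _ : Eu n => G) p x = G := by
    intro x
    simp [coordBilin, chartFrame_self]
    rfl
  simp [christoffelFirst, coordDeriv, h]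

theorem secondForm_const {n : ℕ} (G : Eu n →L[ℝ] Eu n →L[ℝ] ℝ) (f : S → Eu n) (s : S)
    (u v : Eu 2) (w : Eu n) :
    secondForm (𝓡 2) (𝓡 n) (fun _ : Eu n => G) f s u v w =
      G (coordHess (𝓡 2) (𝓡 n) f s u v) w := by
  rw [secondForm, christoffelFirst_const, add_zero]

theorem dmap_continuousLinearMap {m n : ℕ} (L : Eu m →L[ℝ] Eu n) (p : Eu m) :
    dmap (𝓡 m) (𝓡 n) L p = L := by
  unfold dmap
  rw [mfderiv_eq_fderiv]
  exact L.fderiv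

theorem coordHess_continuousLinearMap {m n : ℕ} (L : Eu m →L[ℝ] Eu n) (p : Eu m) :
    coordHess (𝓡 m) (𝓡 n) L p = 0 := by
  have hr : Set.range (𝓡 m) = Set.univ := ModelWithCorners.range_eq_univ _
  have hw : writtenInExtChartAt (𝓡 m) (𝓡 n) p L = L := rfl
  have hd : fderiv ℝ L = fun _ => L := by
    funext x
    exact L.fderiv
  rw [coordHess, hr, hw, fderivWithin_univ, fderivWithin_univ, hd]
  simp

theorem contMDiff_continuousLinearMap {m n : ℕ} (L : Eu m →L[ℝ] Eu n) {k : ℕ∞ω} :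
    ContMDiff (𝓡 m) (𝓡 n) k L :=
  L.contDiff.contMDiff

end MeanCurvature

/-! ### Spatial vectors and unit normals -/

section Euclidean

/-- Spatiality of one argument suffices. With `y = φ_* ν`, the `T`-component of the second
derivative of `φ ∘ ι` plays no role. -/
theorem minkowskiForm_eq_inner_spatial {x y : Eu 4} (hy : y 0 = 0) :
    minkowskiForm x y = inner ℝ (spatial x) (spatial y) := by
  rw [minkowskiForm_apply, hy, PiLp.inner_apply, Fin.sum_univ_three]
  change _ = y 1 * x 1 + y 2 * x 2 + y 3 * x 3
  ring

theorem minkowskiForm_stdVec_zero (x : Eu 4) : minkowskiForm (stdVec 0) x = -x 0 := by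
  rw [minkowskiForm_apply]
  simp [stdVec_apply]

/-- Unit normals of a plane in `ℝ³` that point to the same side agree. -/
theorem eq_of_unit_normal {m n : Eu 3} {a : Fin 2 → Eu 3} (hm : inner ℝ m m = (1 : ℝ))
    (hn : inner ℝ n n = (1 : ℝ)) (hma : ∀ i, inner ℝ m (a i) = (0 : ℝ))
    (hna : ∀ i, inner ℝ n (a i) = (0 : ℝ))
    (ha : (Matrix.of fun i k => (inner ℝ (a i) (a k) : ℝ)).det ≠ 0)
    (hmn : (0 : ℝ) < inner ℝ n m) : m = n := by
  set c : ℝ := inner ℝ n m with hc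
  set A : Matrix (Fin 3) (Fin 3) ℝ := Matrix.of fun i k => (![n, a 0, a 1] : Fin 3 → Eu 3) i k
    with hA
  have hAA : A * A.transpose =
      Matrix.of fun i k => (inner ℝ (![n, a 0, a 1] i) (![n, a 0, a 1] k) : ℝ) := by
    ext i k
    simp only [Matrix.mul_apply, Matrix.transpose_apply, hA, Matrix.of_apply, PiLp.inner_apply,
      RCLike.inner_apply, conj_trivial]
    exact Finset.sum_congr rfl fun j _ => mul_comm _ _
  -- The Gram matrix of `n, a 0, a 1` has the same determinant as that of `a 0, a 1`, so the three
  -- vectors form a basis. The vector `m - c • n` is orthogonal to all of them and hence vanishes.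
  have hdet : A.det ≠ 0 := by
    intro h0
    apply ha
    have h1 := congrArg Matrix.det hAA
    rw [Matrix.det_mul, h0, zero_mul] at h1
    rw [h1, Matrix.det_fin_two, Matrix.det_fin_three]
    have hna' : ∀ i, inner ℝ (a i) n = (0 : ℝ) := fun i => by rw [real_inner_comm]; exact hna i
    simp [-inner_self_eq_norm_sq_to_K, hna, hna', hn]
  have hw : A.mulVec (m - c • n).ofLp = 0 := by
    have h1 : ∀ i, A.mulVec (m - c • n).ofLp i =
        inner ℝ ((![n, a 0, a 1] : Fin 3 → Eu 3) i) (m - c • n) := by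
      intro i
      simp only [Matrix.mulVec, dotProduct, hA, Matrix.of_apply, PiLp.inner_apply,
        RCLike.inner_apply, conj_trivial]
      exact Finset.sum_congr rfl fun j _ => mul_comm _ _
    funext i
    rw [h1, inner_sub_right, inner_smul_right]
    fin_cases i
    · simp only [Fin.zero_eta, Matrix.cons_val_zero, Pi.zero_apply]
      rw [hn, ← hc]
      ring
    · simp only [Fin.mk_one, Matrix.cons_val_one, Matrix.cons_val_zero, Pi.zero_apply]
      rw [real_inner_comm, hma, real_inner_comm, hna]
      ring
    · change inner ℝ (a 1) m - c * inner ℝ (a 1) n = 0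
      rw [real_inner_comm, hma, real_inner_comm, hna]
      ring
  have hmc : m = c • n := by
    have h1 := Matrix.eq_zero_of_mulVec_eq_zero hdet hw
    rw [← sub_eq_zero]
    ext i
    exact congrFun h1 i
  have hcc : c * c = 1 := by
    have : inner ℝ (c • n) (c • n) = (1 : ℝ) := by rw [← hmc]; exact hm
    rw [inner_smul_left, inner_smul_right, hn] at this
    simpa using this
  have : c = 1 := by nlinarith
  rw [hmc, this, one_smul]

end Euclidean

/-! ### The pointwise identity and the comparison of energy and mass -/

section Spacetimes

theorem Spacetime.differentiableWithinAt_coordBilin {M : Type*} [TopologicalSpace M]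
    [ChartedSpace (Eu 4) M] [IsManifold (𝓡 4) ∞ M] (X : Spacetime M) (p : M) :
    DifferentiableWithinAt ℝ (coordBilin (𝓡 4) X.g p) (Set.range (𝓡 4)) (extChartAt (𝓡 4) p p) :=
  (((X.smooth p).contDiffAt (extChartAt_target_mem_nhds p)).differentiableAt
    (by simp)).differentiableWithinAt

theorem det_pos_of_posDef {B : Eu 3 →L[ℝ] Eu 3 →L[ℝ] ℝ} (hsymm : ∀ u v, B u v = B v u)
    (hB : ∀ w, w ≠ 0 → 0 < B w w) {L : Eu 2 →L[ℝ] Eu 3} (hL : Function.Injective L) :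
    0 < (Matrix.of fun i k : Fin 2 => B (L (stdVec i)) (L (stdVec k))).det := by
  have hpos : ∀ w : Eu 2, w ≠ 0 → 0 < B (L w) (L w) := by
    intro w hw
    apply hB
    intro h0
    exact hw (hL (h0.trans (map_zero L).symm))
  have h1 : 0 < B (L (stdVec 1)) (L (stdVec 1)) := by
    apply hpos
    intro h
    have := congrArg (fun x : Eu 2 => x 1) h
    simp [stdVec_apply] at this
  -- The Cauchy–Schwarz vector: the part of `L (stdVec 0)` orthogonal to `L (stdVec 1)`, scaled by
  -- `B (L (stdVec 1)) (L (stdVec 1))`. Its square length is this factor times the determinant.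
  have h2 := hpos (B (L (stdVec 1)) (L (stdVec 1)) • stdVec 0 -
      B (L (stdVec 0)) (L (stdVec 1)) • stdVec 1) (by
    intro h
    have := congrArg (fun x : Eu 2 => x 0) h
    simp [stdVec_apply] at this
    exact h1.ne' this)
  simp only [map_sub, map_smul, sub_apply, smul_apply, smul_eq_mul] at h2
  rw [hsymm (L (stdVec 1)) (L (stdVec 0))] at h2
  rw [Matrix.det_fin_two]
  simp only [Matrix.of_apply]
  rw [hsymm (L (stdVec 1)) (L (stdVec 0))]
  refine pos_of_mul_pos_right (a := B (L (stdVec 1)) (L (stdVec 1))) ?_ h1.le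
  linarith

/-- The Chen-Nester-Tung energy of a matching reference that straightens the normal of `Ω` is the
Brown-York mass. -/
theorem cntEnergy_eq_brownYorkMass
    {M : Type*} [TopologicalSpace M] [ChartedSpace (Eu 4) M] [IsManifold (𝓡 4) ∞ M]
    {Ω : Type*} [TopologicalSpace Ω] [ChartedSpace (EuclideanHalfSpace 3) Ω]
    [IsManifold (𝓡∂ 3) ∞ Ω]
    {S : Type*} [TopologicalSpace S] [ChartedSpace (Eu 2) S] [IsManifold (𝓡 2) ∞ S]
    [CompactSpace S] [T2Space S] (X : Spacetime M)
    {j : Ω → M} (hj : IsSmoothEmb (𝓡∂ 3) (𝓡 4) j)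
    (hΩ : ∀ (q : Ω) (w : Eu 3), w ≠ 0 → 0 < pullbackBilin (𝓡∂ 3) (𝓡 4) j X.g q w w)
    {b : S → Ω} (hb : IsSmoothEmb (𝓡 2) (𝓡∂ 3) b) {ν : S → Eu 3}
    (hν : IsOutwardNormalBoundary (pullbackBilin (𝓡∂ 3) (𝓡 4) j X.g) b ν)
    {U : Set M} {N : M → Eu 4}
    (hnormal : ∀ (s : S) (w : Eu 3),
      X.g (j (b s)) (N (j (b s))) (dmap (𝓡∂ 3) (𝓡 4) j (b s) w) = 0)
    {o : OrientationForm 2 S}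
    (ho : ∀ (s : S) (u v : Eu 2), 0 < o.form s ![u, v] →
      0 < X.orient.form (j (b s)) ![N (j (b s)), dmap (𝓡∂ 3) (𝓡 4) j (b s) (ν s),
        dmap (𝓡 2) (𝓡 4) (j ∘ b) s u, dmap (𝓡 2) (𝓡 4) (j ∘ b) s v])
    {φ : M → Eu 4}
    (hφ : Spacetime.IsMatchingReference X minkowski (Set.range (j ∘ b)) U φ)
    (hφN : ∀ s : S, dmap (𝓡 4) (𝓡 4) φ (j (b s)) (N (j (b s))) = (stdVec 0 : Eu 4))
    {n₀ : S → Eu 3}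
    (hn₀ : IsOutwardNormalEuclidean (fun s => spatial (φ (j (b s)))) n₀)
    (hout : ∀ s : S, 0 < inner ℝ (n₀ s) (spatial (dmap (𝓡 4) (𝓡 4) φ (j (b s))
      (dmap (𝓡∂ 3) (𝓡 4) j (b s) (ν s))))) :
    X.cntEnergy minkowski o (j ∘ b) N φ =
      brownYorkMass o (pullbackBilin (𝓡∂ 3) (𝓡 4) j X.g) b ν
        (fun s => spatial (φ (j (b s)))) n₀ := by
  have hjs : ∀ s, ContMDiffAt (𝓡∂ 3) (𝓡 4) 2 j (b s) := fun s =>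
    (hj.contMDiff (b s)).of_le ENat.LEInfty.out
  have hbs : ∀ s, ContMDiffAt (𝓡 2) (𝓡∂ 3) 2 b s := fun s =>
    (hb.contMDiff s).of_le ENat.LEInfty.out
  have hφs : ∀ s, ContMDiffAt (𝓡 4) (𝓡 4) 2 φ (j (b s)) := fun s =>
    ((hφ.contMDiffOn _ (hφ.subset ⟨s, rfl⟩)).contMDiffAt
      (hφ.isOpen.mem_nhds (hφ.subset ⟨s, rfl⟩))).of_le ENat.LEInfty.out
  have hιs : ∀ s, ContMDiffAt (𝓡 2) (𝓡 4) 2 (j ∘ b) s := fun s => (hjs s).comp s (hbs s)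
  have hψs : ∀ s, ContMDiffAt (𝓡 2) (𝓡 4) 2 (φ ∘ (j ∘ b)) s := fun s =>
    ContMDiffAt.comp s (hφs s) (hιs s)
  have hspat : ∀ x : Eu 4, ContMDiffAt (𝓡 4) (𝓡 3) 2 spatial x :=
    fun x => contMDiff_continuousLinearMap spatial x
  -- the derivatives of the maps involved
  have dι : ∀ s u, dmap (𝓡 2) (𝓡 4) (j ∘ b) s u =
      dmap (𝓡∂ 3) (𝓡 4) j (b s) (dmap (𝓡 2) (𝓡∂ 3) b s u) := fun s u =>
    dmap_comp ((hjs s).mdifferentiableAt two_ne_zero) ((hbs s).mdifferentiableAt two_ne_zero) u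
  have dψ : ∀ s u, dmap (𝓡 2) (𝓡 4) (φ ∘ (j ∘ b)) s u =
      dmap (𝓡 4) (𝓡 4) φ (j (b s)) (dmap (𝓡 2) (𝓡 4) (j ∘ b) s u) := fun s u =>
    dmap_comp (f := φ) (g := j ∘ b) ((hφs s).mdifferentiableAt two_ne_zero)
      ((hιs s).mdifferentiableAt two_ne_zero) u
  have df : ∀ s u, dmap (𝓡 2) (𝓡 3) (fun s => spatial (φ (j (b s)))) s u =
      spatial (dmap (𝓡 2) (𝓡 4) (φ ∘ (j ∘ b)) s u) := by
    intro s u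
    have := dmap_comp (f := spatial) (g := φ ∘ (j ∘ b)) (K := 𝓡 2) (J := 𝓡 4) (I := 𝓡 3) (s := s)
      ((hspat _).mdifferentiableAt two_ne_zero) ((hψs s).mdifferentiableAt two_ne_zero) u
    rw [dmap_continuousLinearMap] at this
    exact this
  have hiso : ∀ s (v w : Eu 4), minkowskiForm (dmap (𝓡 4) (𝓡 4) φ (j (b s)) v)
      (dmap (𝓡 4) (𝓡 4) φ (j (b s)) w) = X.g (j (b s)) v w := by
    intro s v w
    have := hφ.isometric (j (b s)) ⟨s, rfl⟩
    rw [← this]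
    rfl
  -- images of vectors normal to `N` are spatial
  have hzero : ∀ s (w : Eu 4), X.g (j (b s)) (N (j (b s))) w = 0 →
      (dmap (𝓡 4) (𝓡 4) φ (j (b s)) w) 0 = 0 := by
    intro s w hw
    have h1 := hiso s (N (j (b s))) w
    rw [hφN s, hw, minkowskiForm_stdVec_zero] at h1
    linarith
  have hinner : ∀ s (v w : Eu 3),
      inner ℝ (spatial (dmap (𝓡 4) (𝓡 4) φ (j (b s)) (dmap (𝓡∂ 3) (𝓡 4) j (b s) v)))
        (spatial (dmap (𝓡 4) (𝓡 4) φ (j (b s)) (dmap (𝓡∂ 3) (𝓡 4) j (b s) w))) =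
      pullbackBilin (𝓡∂ 3) (𝓡 4) j X.g (b s) v w := by
    intro s v w
    rw [← minkowskiForm_eq_inner_spatial (hzero s _ (hnormal s w)), hiso]
    rfl
  have hdet : ∀ s, 0 < (Matrix.of fun i k : Fin 2 => pullbackBilin (𝓡∂ 3) (𝓡 4) j X.g (b s)
      (dmap (𝓡 2) (𝓡∂ 3) b s (stdVec i)) (dmap (𝓡 2) (𝓡∂ 3) b s (stdVec k))).det := fun s =>
    det_pos_of_posDef (fun v w => X.symm _ _ _) (hΩ (b s)) (hb.injective_dmap s)
  have hframe : ∀ s, IsAdaptedFrame (X.g (j (b s))) (N (j (b s)))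
      (dmap (𝓡∂ 3) (𝓡 4) j (b s) (ν s)) (fun i => dmap (𝓡 2) (𝓡 4) (j ∘ b) s (stdVec i)) := by
    intro s
    refine ⟨X.symm _, ?_, (hν s).1, hnormal s _, fun i => ?_, fun i => ?_, ?_⟩
    -- `N` has unit length because the isometry sends it to `∂/∂T`.
    · rw [← hiso, hφN, minkowskiForm_stdVec_zero]
      simp [stdVec_apply]
    · rw [dι]
      exact hnormal s _
    · rw [dι]
      exact (hν s).2.1 _
    · simp only [dι]
      exact hdet s
  -- the unit normal of the image
  have hn : ∀ s, spatial (dmap (𝓡 4) (𝓡 4) φ (j (b s)) (dmap (𝓡∂ 3) (𝓡 4) j (b s) (ν s))) =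
      n₀ s := by
    intro s
    obtain ⟨_, -, -, -, hD⟩ := hn₀
    refine eq_of_unit_normal (a := fun i => spatial (dmap (𝓡 4) (𝓡 4) φ (j (b s))
      (dmap (𝓡∂ 3) (𝓡 4) j (b s) (dmap (𝓡 2) (𝓡∂ 3) b s (stdVec i)))))
      ?_ (hD s).1 (fun i => ?_) (fun i => ?_) ?_ (hout s)
    · rw [hinner]
      exact (hν s).1
    · rw [hinner]
      exact (hν s).2.1 _
    · have := (hD s).2.1 (stdVec i)
      rwa [df, dψ, dι] at this
    · simp only [hinner]
      exact (hdet s).ne'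
  have hXdiff := X.differentiableWithinAt_coordBilin
  have hYdiff := minkowski.differentiableWithinAt_coordBilin
  -- the mean curvatures in terms of the Christoffel symbols of the two spacetime metrics
  have hk : ∀ s, meanCurvature (𝓡∂ 3) (pullbackBilin (𝓡∂ 3) (𝓡 4) j X.g) b ν s =
      -∑ i, ∑ k, (Matrix.of fun i k => X.g (j (b s)) (dmap (𝓡 2) (𝓡 4) (j ∘ b) s (stdVec i))
          (dmap (𝓡 2) (𝓡 4) (j ∘ b) s (stdVec k)))⁻¹ i k *
        secondForm (𝓡 2) (𝓡 4) X.g (j ∘ b) s (stdVec i) (stdVec k)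
          (dmap (𝓡∂ 3) (𝓡 4) j (b s) (ν s)) := by
    intro s
    rw [meanCurvature_eq_secondForm ((hbs s).mdifferentiableAt two_ne_zero)]
    simp only [secondForm_pullbackBilin (hXdiff _) (X.symm _) (hjs s) (hbs s), dι]
    rfl
  -- Expressed through the same `ι`, frame and normal as `k`, but with the metric `φ^* ḡ`, so that
  -- the two traces can be subtracted term by term.
  have hk₀ : ∀ s, meanCurvature (𝓡 3) (fun _ => euclidForm 3)
        (fun s => spatial (φ (j (b s)))) n₀ s =
      -∑ i, ∑ k, (Matrix.of fun i k => X.g (j (b s)) (dmap (𝓡 2) (𝓡 4) (j ∘ b) s (stdVec i))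
          (dmap (𝓡 2) (𝓡 4) (j ∘ b) s (stdVec k)))⁻¹ i k *
        secondForm (𝓡 2) (𝓡 4) (pullbackBilin (𝓡 4) (𝓡 4) φ minkowski.g) (j ∘ b) s (stdVec i)
          (stdVec k) (dmap (𝓡∂ 3) (𝓡 4) j (b s) (ν s)) := by
    intro s
    have hfs : ContMDiffAt (𝓡 2) (𝓡 3) 2 (fun s => spatial (φ (j (b s)))) s :=
      ContMDiffAt.comp (g := spatial) s (hspat _) (hψs s)
    have hh : (Matrix.of fun i k : Fin 2 => euclidForm 3
        (dmap (𝓡 2) (𝓡 3) (fun s => spatial (φ (j (b s)))) s (stdVec i))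
        (dmap (𝓡 2) (𝓡 3) (fun s => spatial (φ (j (b s)))) s (stdVec k))) =
        Matrix.of fun i k => X.g (j (b s)) (dmap (𝓡 2) (𝓡 4) (j ∘ b) s (stdVec i))
          (dmap (𝓡 2) (𝓡 4) (j ∘ b) s (stdVec k)) := by
      ext i k
      simp only [Matrix.of_apply, euclidForm_apply, df, dψ, dι, hinner]
      rfl
    rw [meanCurvature_eq_secondForm (hfs.mdifferentiableAt two_ne_zero), hh]
    congr 1
    refine Finset.sum_congr rfl fun i _ => Finset.sum_congr rfl fun k _ => ?_
    rw [secondForm_pullbackBilin (f := φ) (g := j ∘ b) (hYdiff _) (minkowski.symm _) (hφs s) (hιs s)]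
    congr 1
    -- Both flat metrics have vanishing Christoffel symbols, so only second derivatives are
    -- compared, and `spatial` is linear.
    refine (secondForm_const _ _ _ _ _ _).trans (Eq.trans ?_ (secondForm_const _ _ _ _ _ _).symm)
    have h1 := coordHess_comp (f := spatial) (g := φ ∘ (j ∘ b)) (K := 𝓡 2) (J := 𝓡 4) (I := 𝓡 3)
      (s := s) (hspat _) (hψs s) (stdVec i) (stdVec k)
    rw [dmap_continuousLinearMap, coordHess_continuousLinearMap] at h1
    simp only [zero_apply, zero_add] at h1
    refine Eq.trans ?_ (minkowskiForm_eq_inner_spatial (hzero s _ (hnormal s (ν s)))).symm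
    rw [hn s, ← h1]
    rfl
  have hmetric : ∀ s, X.g (j (b s)) = pullbackBilin (𝓡 4) (𝓡 4) φ minkowski.g (j (b s)) :=
    fun s => (hφ.isometric (j (b s)) ⟨s, rfl⟩).symm
  have hpt : ∀ (s : S) (u v : Eu 2),
      Spacetime.cntForm X.orient X.g (pullbackBilin (𝓡 4) (𝓡 4) φ minkowski.g) N ((j ∘ b) s)
        (dmap (𝓡 2) (𝓡 4) (j ∘ b) s u) (dmap (𝓡 2) (𝓡 4) (j ∘ b) s v) =
      2 * ((meanCurvature (𝓡 3) (fun _ => euclidForm 3) (fun s => spatial (φ (j (b s)))) n₀ s -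
          meanCurvature (𝓡∂ 3) (pullbackBilin (𝓡∂ 3) (𝓡 4) j X.g) b ν s) *
        volForm o (pullbackBilin (𝓡 2) (𝓡∂ 3) b (pullbackBilin (𝓡∂ 3) (𝓡 4) j X.g)) s
          ![u, v]) := by
    intro s u v
    have hYpull := differentiableWithinAt_coordBilin_pullbackBilin (hYdiff _) (hφs s)
    have hdec : ∀ u : Eu 2, dmap (𝓡 2) (𝓡 4) (j ∘ b) s u =
        u 0 • dmap (𝓡 2) (𝓡 4) (j ∘ b) s (stdVec 0) +
          u 1 • dmap (𝓡 2) (𝓡 4) (j ∘ b) s (stdVec 1) := by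
      intro u
      conv_lhs => rw [← sum_smul_stdVec u]
      simp
    have hform := cntForm_eq_of_isAdaptedFrame (o := X.orient) (N := N) (hXdiff (j (b s))) hYpull
      (hmetric s) (fun a v w => by
        have h1 := coordDeriv_eq_of_eq_along (f := j ∘ b) (hXdiff (j (b s))) hYpull (hιs s) hmetric
          (a 0 • stdVec 0 + a 1 • stdVec 1) v w
        simp only [map_add, map_smul] at h1
        exact h1) (hframe s) u v
    have hvol := volForm_surface (o := X.orient) (o₂ := o)
      (h := pullbackBilin (𝓡 2) (𝓡∂ 3) b (pullbackBilin (𝓡∂ 3) (𝓡 4) j X.g)) (s := s) (hframe s)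
      (fun i k => by rw [dι, dι]; rfl) (ho s _ _) (ho s _ _) u v
    rw [hdec u, hdec v, hvol]
    refine hform.trans ?_
    rw [hk, hk₀, neg_sub_neg, ← Finset.sum_sub_distrib, mul_assoc]
    congr 2
    refine Finset.sum_congr rfl fun i _ => ?_
    rw [← Finset.sum_sub_distrib]
    refine Finset.sum_congr rfl fun k _ => ?_
    -- The metrics agree at the point, so the terms with the second derivative of `ι` cancel and
    -- only Christoffel symbols are left.
    rw [secondForm, secondForm, ← mul_sub]
    congr 1
    simp only [Function.comp_apply, hmetric s]
    ring
  rw [Spacetime.cntEnergy, brownYorkMass, areaIntegral]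
  simp only [hpt]
  rw [formIntegral_const_mul]
  -- The pointwise factor `2` turns `1 / (2 * 8π)` into `1 / (8π)`.
  ring

end Spacetimes

theorem corollary1p2
    {M : Type*} [TopologicalSpace M] [ChartedSpace (Eu 4) M] [IsManifold (𝓡 4) ∞ M]
    {Ω : Type*} [TopologicalSpace Ω] [ChartedSpace (EuclideanHalfSpace 3) Ω]
    [IsManifold (𝓡∂ 3) ∞ Ω] [CompactSpace Ω]
    {S : Type*} [TopologicalSpace S] [ChartedSpace (Eu 2) S] [IsManifold (𝓡 2) ∞ S]
    [CompactSpace S] [T2Space S]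
    -- the physical spacetime
    (X : Spacetime M)
    -- the compact spacelike domain `Ω` in `M`, with boundary `S` and outward unit normal `ν`
    (j : Ω → M) (hj : IsSmoothEmb (𝓡∂ 3) (𝓡 4) j)
    (hΩ : ∀ (q : Ω) (w : TangentSpace (𝓡∂ 3) q), w ≠ 0 →
      0 < pullbackBilin (𝓡∂ 3) (𝓡 4) j X.g q w w)
    (b : S → Ω) (hb : IsSmoothEmb (𝓡 2) (𝓡∂ 3) b) (hbS : Set.range b = (𝓡∂ 3).boundary Ω)
    (ν : ∀ s : S, TangentSpace (𝓡∂ 3) (b s))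
    (hν : IsOutwardNormalBoundary (pullbackBilin (𝓡∂ 3) (𝓡 4) j X.g) b ν)
    -- the future-directed timelike field `N`, defined and smooth near `S` and normal to `Ω` on `S`
    (U : Set M) (N : ∀ p : M, TangentSpace (𝓡 4) p)
    (hN : ContMDiffOn (𝓡 4) (𝓡 4).tangent ∞ (fun p => (⟨p, N p⟩ : TangentBundle (𝓡 4) M)) U)
    (hNfuture : ∀ s : S, X.Future (j (b s)) (N (j (b s))))
    (hNnormal : ∀ (s : S) (w : TangentSpace (𝓡∂ 3) (b s)),
      X.g (j (b s)) (N (j (b s))) (dmap (𝓡∂ 3) (𝓡 4) j (b s) w) = 0)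
    -- `N`, the outward normal and the orientation of `S` form the orientation of `M`
    (o : OrientationForm 2 S)
    (ho : ∀ (s : S) (u v : TangentSpace (𝓡 2) s), 0 < o.form s ![u, v] →
      0 < X.orient.form (j (b s)) ![N (j (b s)), dmap (𝓡∂ 3) (𝓡 4) j (b s) (ν s),
        dmap (𝓡 2) (𝓡 4) (j ∘ b) s u, dmap (𝓡 2) (𝓡 4) (j ∘ b) s v])
    -- the reference, with `φ_* N = ∂/∂T` and `φ(S)` contained in a slice `{T = c}`, i.e. in `ℝ³`
    (φ : M → Eu 4)
    (hφ : Spacetime.IsMatchingReference X minkowski (Set.range (j ∘ b)) U φ)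
    (hφN : ∀ s : S, dmap (𝓡 4) (𝓡 4) φ (j (b s)) (N (j (b s))) = (stdVec 0 : Eu 4))
    (c : ℝ) (hφS : ∀ s : S, φ (j (b s)) 0 = c)
    -- the outward unit normal of `φ(S)` in `ℝ³`, and `φ` maps the outward side to the outward side
    (n₀ : S → Eu 3)
    (hn₀ : IsOutwardNormalEuclidean (fun s => spatial (φ (j (b s)))) n₀)
    (hout : ∀ s : S, 0 < inner ℝ (n₀ s) (spatial (dmap (𝓡 4) (𝓡 4) φ (j (b s))
      (dmap (𝓡∂ 3) (𝓡 4) j (b s) (ν s))))) :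
    X.cntEnergy minkowski o (j ∘ b) N φ =
      brownYorkMass o (pullbackBilin (𝓡∂ 3) (𝓡 4) j X.g) b ν
        (fun s => spatial (φ (j (b s)))) n₀ := by
  exact cntEnergy_eq_brownYorkMass X hj hΩ hb hν hNnormal ho hφ hφN hn₀ hout
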